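/- Let $\Lambda$ be a Nakayama algebra, i.e. an artin algebra over a commutative artinian ring such that all indecomposable projective left modules and all indecomposable projective right modules are uniserial, and assume that no simple left $\Lambda$-module is projective. Modules are left $\Lambda$-modules of finite length. For a module $M$ let $P(M)\to M$ be a projective cover, $\Omega M$ its kernel, $\operatorname{top} M = M/\operatorname{rad} M$, $\operatorname{soc} M$ the socle, and $\tau = D\operatorname{Tr}$ the Auslander--Reiten translation. A module $M$ is Gorenstein projective if there is an exact complex $P_\bullet = (P_i,\delta_i)_{i\in\mathbb Z}$ of projective modules such that $\operatorname{Hom}_\Lambda(P_\bullet,\Lambda)$ is also exact and $M \cong \operatorname{Im}\delta_0$. The resolution quiver of $\Lambda$ has as vertices the isomorphism classes of simple $\Lambda$-modules, and for every simple module $S$ exactly one arrow starts at $S$, namely $S\to \gamma S := \tau\operatorname{soc}P(S)$. A simple module is black if its projective dimension is at least $2$; a vertex is cyclically black if it lies on a cycle of the resolution quiver all of whose vertices are black. Let $M$ be an indecomposable non-projective $\Lambda$-module. Then the following conditions are equivalent: (i) $M$ is Gorenstein projective. (ii) Both $\operatorname{top} M$ and $\operatorname{top}\Omega M$ are cyclically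 black. (iii) Both $\operatorname{top} M$ and $\tau\operatorname{soc} M$ are cyclically black. -/

import Mathlib

universe u

/-! ### Modules: indecomposability, uniseriality, top and socle -/

/-- A module is indecomposable if it is non-zero and not the direct sum of two non-zero
submodules. -/
def IsIndecomposable (Λ : Type u) [Ring Λ] (M : Type u) [AddCommGroup M] [Module Λ M] : Prop :=
  Nontrivial M ∧ ∀ A B : Submodule Λ M, IsCompl A B → A = ⊥ ∨ B = ⊥

/-- A module is uniserial if its submodules form a chain. -/
def IsUniserial (Λ : Type u) [Ring Λ] (M : Type u) [AddCommGroup M] [Module Λ M] : Prop :=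
  ∀ A B : Submodule Λ M, A ≤ B ∨ B ≤ A

/-- Every indecomposable finitely generated projective (left) module is uniserial. -/
def IsLeftSerial (Λ : Type u) [Ring Λ] : Prop :=
  ∀ (P : Type u) [AddCommGroup P] [Module Λ P], Module.Finite Λ P → Module.Projective Λ P →
    IsIndecomposable Λ P → IsUniserial Λ P

/-- A Nakayama algebra is an artin `R`-algebra (`R` is a commutative artinian ring and `Λ` is
finitely generated as an `R`-module) such that all indecomposable projective left modules and all
indecomposable projective right modules are uniserial. Right `Λ`-modules are `Λᵐᵒᵖ`-modules. -/
structure IsNakayamaAlgebra (R Λ : Type u) [CommRing R] [Ring Λ] [Algebra R Λ] : Prop where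
  isArtinianRing : IsArtinianRing R
  finite : Module.Finite R Λ
  left : IsLeftSerial Λ
  right : IsLeftSerial Λᵐᵒᵖ

/-- No simple (left) module is projective. -/
def NoSimpleProjective (Λ : Type u) [Ring Λ] : Prop :=
  ∀ (S : Type u) [AddCommGroup S] [Module Λ S], IsSimpleModule Λ S → ¬ Module.Projective Λ S

/-- The top `M / rad M`, where `rad M` is the intersection of the maximal submodules. -/
abbrev ModuleTop (Λ : Type u) [Ring Λ] (M : Type u) [AddCommGroup M] [Module Λ M] : Type u :=
  M ⧸ Module.jacobson Λ M

/-- The socle, the sum of the simple submodules. -/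
def socle (Λ : Type u) [Ring Λ] (M : Type u) [AddCommGroup M] [Module Λ M] : Submodule Λ M :=
  sSup {N : Submodule Λ M | IsSimpleModule Λ N}

/-! ### Projective covers and syzygies -/

/-- `π : P → M` is a projective cover: `P` is projective, `π` is surjective, and the kernel of `π`
is superfluous. -/
structure IsProjectiveCover {Λ : Type u} [Ring Λ] {P M : Type u} [AddCommGroup P] [Module Λ P]
    [AddCommGroup M] [Module Λ M] (π : P →ₗ[Λ] M) : Prop where
  projective : Module.Projective Λ P
  surjective : Function.Surjective π
  superfluous : ∀ N : Submodule Λ P, N ⊔ LinearMap.ker π = ⊤ → N = ⊤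

theorem exists_isProjectiveCover (Λ : Type u) [Ring Λ] [IsArtinianRing Λ] (M : Type u)
    [AddCommGroup M] [Module Λ M] [Module.Finite Λ M] :
    ∃ p : (Σ P : ModuleCat.{u} Λ, P →ₗ[Λ] M), IsProjectiveCover p.2 := by
  obtain ⟨n, f, hf⟩ := Module.Finite.exists_fin' Λ M
  obtain ⟨N, hN, hmin⟩ := WellFounded.has_min
    (wellFounded_lt : WellFounded (fun A B : Submodule Λ (Fin n → Λ) => A < B))
    {A | A.map f = ⊤} ⟨⊤, by simpa [LinearMap.range_eq_top] using hf⟩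
  have hN' : N.map f = ⊤ := hN
  have hle : ∀ A : Submodule Λ (Fin n → Λ), A ≤ N → A.map f = ⊤ → A = N := by
    intro A hA h
    by_contra hne
    exact hmin A h (lt_of_le_of_ne hA hne)
  let π : N →ₗ[Λ] M := f ∘ₗ N.subtype
  have hπ : Function.Surjective π := by
    rw [← LinearMap.range_eq_top, LinearMap.range_comp, Submodule.range_subtype, hN']
  have key : ∀ B : Submodule Λ N, B.map π = ⊤ → B = ⊤ := by
    intro B hB
    have h1 : B.map N.subtype = N :=
      hle _ (Submodule.map_subtype_le N B) (by rw [← Submodule.map_comp]; exact hB)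
    have h2 : B.map N.subtype = (⊤ : Submodule Λ N).map N.subtype := by
      rw [h1, Submodule.map_top, Submodule.range_subtype]
    exact Submodule.map_injective_of_injective N.injective_subtype h2
  obtain ⟨g, hg⟩ := Module.projective_lifting_property π f hπ
  let e : N →ₗ[Λ] N := g ∘ₗ N.subtype
  have he : Function.Surjective e := by
    rw [← LinearMap.range_eq_top]
    apply key
    rw [← LinearMap.range_comp, LinearMap.range_eq_top]
    have : π ∘ₗ e = π := by
      change (π ∘ₗ g) ∘ₗ N.subtype = π
      rw [hg]
    rw [this]; exact hπ
  have he' : Function.Injective e := IsNoetherian.injective_of_surjective_endomorphism e he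
  let e' : N ≃ₗ[Λ] N := LinearEquiv.ofBijective e ⟨he', he⟩
  have hproj : Module.Projective Λ N :=
    Module.Projective.of_split N.subtype (e'.symm.toLinearMap ∘ₗ g) (by
      refine LinearMap.ext fun x => ?_
      exact e'.symm_apply_apply x)
  refine ⟨⟨ModuleCat.of Λ N, π⟩, hproj, hπ, ?_⟩
  intro B hB
  apply key
  have h := congrArg (Submodule.map π) hB
  rw [Submodule.map_sup] at h
  have h0 : (LinearMap.ker π).map π = ⊥ := by
    rw [eq_bot_iff]
    rintro _ ⟨x, hx, rfl⟩
    exact hx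
  rw [h0, sup_bot_eq, Submodule.map_top, LinearMap.range_eq_top.mpr hπ] at h
  exact h

/-- A chosen projective cover of `M` (it exists for all finitely generated modules over an
artinian ring, and is unique up to isomorphism). -/
noncomputable def projectiveCover (Λ : Type u) [Ring Λ] (M : Type u) [AddCommGroup M]
    [Module Λ M] : Σ P : ModuleCat.{u} Λ, P →ₗ[Λ] M :=
  @Classical.epsilon _ ⟨⟨ModuleCat.of Λ M, LinearMap.id⟩⟩ (fun p => IsProjectiveCover p.2)

/-- The module `P(M)`. -/
abbrev ProjCover (Λ : Type u) [Ring Λ] (M : Type u) [AddCommGroup M] [Module Λ M] : Type u :=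
  (projectiveCover Λ M).1

/-- The map `P(M) → M`. -/
noncomputable abbrev projCoverMap (Λ : Type u) [Ring Λ] (M : Type u) [AddCommGroup M]
    [Module Λ M] : ProjCover Λ M →ₗ[Λ] M :=
  (projectiveCover Λ M).2

theorem isProjectiveCover_projCoverMap (Λ : Type u) [Ring Λ] [IsArtinianRing Λ] (M : Type u)
    [AddCommGroup M] [Module Λ M] [Module.Finite Λ M] : IsProjectiveCover (projCoverMap Λ M) :=
  Classical.epsilon_spec (p := fun p : (Σ P : ModuleCat.{u} Λ, P →ₗ[Λ] M) =>
    IsProjectiveCover p.2) (exists_isProjectiveCover Λ M)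

/-- The first syzygy module `Ω M`, as a submodule of `P(M)`. -/
noncomputable def syzygy (Λ : Type u) [Ring Λ] (M : Type u) [AddCommGroup M] [Module Λ M] :
    Submodule Λ (ProjCover Λ M) :=
  LinearMap.ker (projCoverMap Λ M)

/-! ### Gorenstein projective modules -/

/-- `(P, d)` with `d i : P (i + 1) → P i` is a complete projective resolution: an exact complex
of (finitely generated) projective modules which remains exact under `Hom(-, Λ)`. -/
structure IsCompleteProjectiveResolution (Λ : Type u) [Ring Λ] (P : ℤ → ModuleCat.{u} Λ)
    (d : ∀ i : ℤ, P (i + 1) →ₗ[Λ] P i) : Prop where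
  finite : ∀ i, Module.Finite Λ (P i)
  projective : ∀ i, Module.Projective Λ (P i)
  exact : ∀ i, Function.Exact (d (i + 1)) (d i)
  exact_dual : ∀ i, Function.Exact (fun g : P i →ₗ[Λ] Λ => g ∘ₗ d i)
    (fun g : P (i + 1) →ₗ[Λ] Λ => g ∘ₗ d (i + 1))

/-- `M` is Gorenstein projective: it is (isomorphic to) the image of one of the maps of a complete
projective resolution. -/
def IsGorensteinProjective (Λ : Type u) [Ring Λ] (M : Type u) [AddCommGroup M] [Module Λ M] :
    Prop :=
  ∃ (P : ℤ → ModuleCat.{u} Λ) (d : ∀ i : ℤ, P (i + 1) →ₗ[Λ] P i),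
    IsCompleteProjectiveResolution Λ P d ∧ Nonempty (M ≃ₗ[Λ] LinearMap.range (d 0))

/-! ### Injective envelopes and the duality `D` -/

/-- `ι : N → E` is an injective envelope: `E` is injective and `ι` is an essential
monomorphism. -/
structure IsInjectiveEnvelope {R : Type u} [Ring R] {N E : Type u} [AddCommGroup N] [Module R N]
    [AddCommGroup E] [Module R E] (ι : N →ₗ[R] E) : Prop where
  injective_module : Module.Injective R E
  injective : Function.Injective ι
  essential : ∀ A : Submodule R E, A ⊓ LinearMap.range ι = ⊥ → A = ⊥

theorem exists_isInjectiveEnvelope (R : Type u) [Ring R] (N : Type u) [AddCommGroup N]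
    [Module R N] : ∃ p : (Σ E : ModuleCat.{u} R, N →ₗ[R] E), IsInjectiveEnvelope p.2 := by
  obtain ⟨⟨I, hI, j, hj⟩⟩ :=
    CategoryTheory.EnoughInjectives.presentation (C := ModuleCat.{u} R) (ModuleCat.of R N)
  have hjinj : Function.Injective j.hom := (ModuleCat.mono_iff_injective j).mp hj
  have hInj : Module.Injective R I := Module.injective_module_of_injective_object R I
  let N' : Submodule R I := LinearMap.range j.hom
  let 𝒮 : Set (Submodule R I) := {E | ∀ A ≤ E, A ⊓ N' = ⊥ → A = ⊥}
  have hN' : N' ∈ 𝒮 := fun A hA h => by rwa [inf_eq_left.mpr hA] at h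
  obtain ⟨E, hNE, hE⟩ := zorn_le_nonempty₀ 𝒮 (by
    intro c hc hchain y hy
    refine ⟨sSup c, ?_, fun z hz => le_sSup hz⟩
    intro A hA hAN
    rw [eq_bot_iff]
    intro x hx
    obtain ⟨E, hEc, hxE⟩ := (Submodule.mem_sSup_of_directed ⟨y, hy⟩ hchain.directedOn).mp (hA hx)
    have h1 : Submodule.span R {x} ≤ E := by simpa [Submodule.span_le] using hxE
    have h2 : Submodule.span R {x} ≤ A := by simpa [Submodule.span_le] using hx
    have h3 := hc hEc _ h1 (by rw [eq_bot_iff, ← hAN]; exact inf_le_inf_right _ h2)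
    rw [Submodule.mem_bot]
    exact Submodule.span_singleton_eq_bot.mp h3) N' hN'
  obtain ⟨C, -, hC⟩ := zorn_le_nonempty₀ {C : Submodule R I | C ⊓ E = ⊥} (by
    intro c hc hchain y hy
    refine ⟨sSup c, ?_, fun z hz => le_sSup hz⟩
    change sSup c ⊓ E = ⊥
    rw [eq_bot_iff]
    rintro x ⟨hx, hxE⟩
    obtain ⟨C, hCc, hxC⟩ := (Submodule.mem_sSup_of_directed ⟨y, hy⟩ hchain.directedOn).mp hx
    have h3 : C ⊓ E = ⊥ := hc hCc
    rw [← h3]; exact ⟨hxC, hxE⟩) ⊥ (by simp)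
  have hCE : C ⊓ E = ⊥ := hC.prop
  have hCmax : ∀ B : Submodule R I, C ≤ B → B ⊓ E = ⊥ → B = C :=
    fun B hB h => le_antisymm (hC.le_of_ge h hB) hB
  have hφ : Function.Injective (C.mkQ ∘ₗ E.subtype) := by
    rw [← LinearMap.ker_eq_bot, eq_bot_iff]
    rintro ⟨x, hx⟩ h
    have h1 : x ∈ C := by simpa using h
    have h2 : x ∈ C ⊓ E := ⟨h1, hx⟩
    rw [hCE] at h2
    simpa using h2
  obtain ⟨h, hh⟩ := hInj.out (C.mkQ ∘ₗ E.subtype) hφ E.subtype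
  have hh' : ∀ x ∈ E, h (C.mkQ x) = x := fun x hx => hh ⟨x, hx⟩
  have hER : E ≤ LinearMap.range h := fun x hx => ⟨_, hh' x hx⟩
  have hRS : LinearMap.range h ∈ 𝒮 := by
    intro A hA hAN
    have h1 : A ⊓ E = ⊥ := by
      refine hE.prop _ inf_le_right ?_
      rw [eq_bot_iff, ← hAN]
      exact inf_le_inf_right _ inf_le_left
    have h2 : (A.comap h).comap C.mkQ = C := by
      apply hCmax
      · intro x hx
        have : C.mkQ x = 0 := by simpa using hx
        simp only [Submodule.mem_comap, this, map_zero, A.zero_mem]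
      · rw [eq_bot_iff]
        rintro x ⟨hx, hxE⟩
        rw [← h1]
        refine ⟨?_, hxE⟩
        have : h (C.mkQ x) ∈ A := hx
        rwa [hh' x hxE] at this
    rw [eq_bot_iff]
    intro a ha
    obtain ⟨y, rfl⟩ := hA ha
    obtain ⟨z, rfl⟩ := C.mkQ_surjective y
    have hz : z ∈ (A.comap h).comap C.mkQ := ha
    rw [h2] at hz
    have : C.mkQ z = 0 := by simpa using hz
    rw [this, map_zero]
    exact Submodule.zero_mem _
  have hRE : LinearMap.range h ≤ E := hE.le_of_ge hRS hER
  let r : I →ₗ[R] E := (h ∘ₗ C.mkQ).codRestrict E (fun x => hRE ⟨_, rfl⟩)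
  have hr : ∀ x : E, r x = x := fun x => Subtype.ext (hh' x x.2)
  have hEinj : Module.Injective R E := ⟨by
    intro X Y _ _ _ _ f hf g
    obtain ⟨k, hk⟩ := hInj.out f hf (E.subtype ∘ₗ g)
    refine ⟨r ∘ₗ k, fun x => ?_⟩
    rw [LinearMap.comp_apply, hk]
    exact hr (g x)⟩
  let ι : N →ₗ[R] E := j.hom.codRestrict E (fun x => hNE ⟨x, rfl⟩)
  refine ⟨⟨ModuleCat.of R E, ι⟩, hEinj, ?_, ?_⟩
  · intro x y hxy
    exact hjinj (congrArg Subtype.val hxy)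
  · intro A hA
    have h1 : A.map E.subtype = ⊥ := by
      refine hE.prop _ (Submodule.map_subtype_le E A) ?_
      rw [eq_bot_iff]
      rintro _ ⟨⟨a, ha, rfl⟩, ⟨n, hn⟩⟩
      have h2 : a ∈ A ⊓ LinearMap.range ι := ⟨ha, ⟨n, Subtype.ext hn⟩⟩
      rw [hA] at h2
      have h3 : a = 0 := h2
      rw [h3]; simp
    rw [eq_bot_iff]
    intro a ha
    have h4 : (a : I) ∈ A.map E.subtype := ⟨a, ha, rfl⟩
    rw [h1] at h4
    exact Subtype.ext h4

/-- The injective envelope of `R / rad R` as an `R`-module (a minimal injective cogenerator if `R`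
is artinian). -/
noncomputable def dualizingModule (R : Type u) [CommRing R] : ModuleCat.{u} R :=
  (exists_isInjectiveEnvelope R (R ⧸ Ring.jacobson R)).choose.1

/-- The dual `D X = Hom_R(X, E)` of a right `Λ`-module `X`, where `E` is the injective envelope of
`R / rad R`. -/
def DualModule (R X : Type u) [CommRing R] [AddCommGroup X] [Module R X] : Type u :=
  X →ₗ[R] dualizingModule R

noncomputable instance dualModuleAddCommGroup (R X : Type u) [CommRing R] [AddCommGroup X] [Module R X] :
    AddCommGroup (DualModule R X) :=
  inferInstanceAs (AddCommGroup (X →ₗ[R] dualizingModule R))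

/-- The left `Λ`-module structure on `D X`, given by `(a • φ) x = φ (x a)`. -/
noncomputable instance dualModuleModule (R Λ X : Type u) [CommRing R] [Ring Λ] [Algebra R Λ] [AddCommGroup X]
    [Module R X] [Module Λᵐᵒᵖ X] [IsScalarTower R Λᵐᵒᵖ X] : Module Λ (DualModule R X) where
  smul a φ := LinearMap.comp (M₃ := dualizingModule R) φ
    (DistribSMul.toLinearMap R X (MulOpposite.op a))
  one_smul φ := LinearMap.ext fun x => congrArg φ.toFun (one_smul Λᵐᵒᵖ x)
  mul_smul a b φ := LinearMap.ext fun x =>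
    congrArg φ.toFun (mul_smul (MulOpposite.op b) (MulOpposite.op a) x)
  smul_zero _ := LinearMap.ext fun _ => rfl
  smul_add _ _ _ := LinearMap.ext fun _ => rfl
  add_smul a b φ := LinearMap.ext fun x =>
    (congrArg φ.toFun (add_smul (MulOpposite.op a) (MulOpposite.op b) x)).trans (φ.map_add _ _)
  zero_smul φ := LinearMap.ext fun x =>
    (congrArg φ.toFun (zero_smul Λᵐᵒᵖ x)).trans φ.map_zero

/-! ### The Auslander-Reiten translation `τ = D Tr` -/

/-- The map `P₁(M) = P(Ω M) → P₀(M) = P(M)` of the minimal projective presentation of `M`. -/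
noncomputable def presentationMap (Λ : Type u) [Ring Λ] (M : Type u) [AddCommGroup M]
    [Module Λ M] : ProjCover Λ (syzygy Λ M) →ₗ[Λ] ProjCover Λ M :=
  (syzygy Λ M).subtype ∘ₗ projCoverMap Λ (syzygy Λ M)

/-- `Hom(f, Λ) : Hom(Q, Λ) → Hom(P, Λ)` as a map of right `Λ`-modules. -/
def homToRing {Λ : Type u} [Ring Λ] {P Q : Type u} [AddCommGroup P] [Module Λ P]
    [AddCommGroup Q] [Module Λ Q] (f : P →ₗ[Λ] Q) : (Q →ₗ[Λ] Λ) →ₗ[Λᵐᵒᵖ] (P →ₗ[Λ] Λ) where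
  toFun g := g ∘ₗ f
  map_add' _ _ := rfl
  map_smul' _ _ := rfl

/-- The transpose `Tr M`, the cokernel of `Hom(P₀(M), Λ) → Hom(P₁(M), Λ)`, a right module. -/
abbrev Transpose (Λ : Type u) [Ring Λ] (M : Type u) [AddCommGroup M] [Module Λ M] : Type u :=
  (ProjCover Λ (syzygy Λ M) →ₗ[Λ] Λ) ⧸ LinearMap.range (homToRing (presentationMap Λ M))

/-- The Auslander-Reiten translate `τ M = D Tr M`. -/
abbrev ARTranslate (R Λ : Type u) [CommRing R] [Ring Λ] [Algebra R Λ] (M : Type u)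
    [AddCommGroup M] [Module Λ M] : Type u :=
  DualModule R (Transpose Λ M)

/-! ### The resolution quiver -/

/-- `γ S = τ soc P(S)`. -/
abbrev ResolutionMap (R Λ : Type u) [CommRing R] [Ring Λ] [Algebra R Λ] (S : Type u)
    [AddCommGroup S] [Module Λ S] : Type u :=
  ARTranslate R Λ (socle Λ (ProjCover Λ S))

/-- The arrows of the resolution quiver: there is an arrow `S → T` if and only if `T ≅ γ S`. The
vertices are the isomorphism classes of simple modules; a vertex is given here by any simple
module in the class. -/
def ResolutionArrow (R Λ : Type u) [CommRing R] [Ring Λ] [Algebra R Λ] (S T : Type u)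
    [AddCommGroup S] [Module Λ S] [AddCommGroup T] [Module Λ T] : Prop :=
  Nonempty (T ≃ₗ[Λ] ResolutionMap R Λ S)

/-- A simple module is black if its projective dimension is at least `2`. -/
def IsBlack (Λ : Type u) [Ring Λ] (S : Type u) [AddCommGroup S] [Module Λ S] : Prop :=
  2 ≤ CategoryTheory.projectiveDimension (ModuleCat.of Λ S)

/-- `c 0 → c 1 → ⋯ → c n → c 0` is a black cycle of the resolution quiver: the `c i` are simple
modules which represent pairwise different vertices, there are arrows `c i → c (i + 1)` (with
indices modulo `n + 1`), and all vertices `c i` are black. For `n = 0` this is a black loop. -/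
structure IsBlackCycle (R Λ : Type u) [CommRing R] [Ring Λ] [Algebra R Λ] {n : ℕ}
    (c : Fin (n + 1) → ModuleCat.{u} Λ) : Prop where
  simple : ∀ i, IsSimpleModule Λ (c i)
  distinct : ∀ i j, Nonempty (c i ≃ₗ[Λ] c j) → i = j
  arrow : ∀ i, ResolutionArrow R Λ (c i) (c (i + 1))
  black : ∀ i, IsBlack Λ (c i)

/-- `S` is a cyclically black vertex of the resolution quiver: it is (isomorphic to) a simple
module which lies on a black cycle. -/
def IsCyclicallyBlack (R Λ : Type u) [CommRing R] [Ring Λ] [Algebra R Λ] (S : Type u)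
    [AddCommGroup S] [Module Λ S] : Prop :=
  ∃ (n : ℕ) (c : Fin (n + 1) → ModuleCat.{u} Λ),
    IsBlackCycle R Λ c ∧ ∃ i, Nonempty (S ≃ₗ[Λ] c i)

/-! ### Submodules, quotients, top and socle of uniserial modules -/

section Uniserial

variable {Λ : Type u} [Ring Λ] {M N S : Type u} [AddCommGroup M] [Module Λ M]
  [AddCommGroup N] [Module Λ N] [AddCommGroup S] [Module Λ S]

/-! Over a Nakayama algebra indecomposable modules of finite length are uniserial
(`IsIndecomposable.isUniserial`), and τS is the top of rad P(S) for S simple. Hence, if N is a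
non-zero proper quotient of a uniserial module, the kernel has top τ soc N
(`nonempty_top_ker_equiv_translate_socle`). In particular top ΩM ≅ τ soc M, which makes (ii) and
(iii) equivalent; and a non-zero second syzygy of M has top γ top M, so second syzygies follow the
arrows of the resolution quiver.

Uniseriality on the right is used as a factorization property: of two maps from one principal
indecomposable module to others, one factors through the other
(`IsPrincipalIndecomposable.exists_eq_comp_or`). It gives the description of τ, its injectivity on
simple modules, and the key extension property: if rad Q is not projective, maps from non-zero
submodules of Q to Λ extend to Q (`IsPrincipalIndecomposable.exists_extension`). Since top Q is
black exactly when rad Q is not projective, this ties blackness to exactness of the dual complex.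

From (i) to (ii): a non-projective indecomposable Gorenstein projective module has a black top and
is a syzygy of another such module, the cokernel of a left approximation. Repeating this and keeping
every second module gives an infinite backward walk through black vertices. There are finitely many
simple modules and γ is a function, so the walk starts on a cycle (`isCyclicallyBlack_of_sequence`).
This applies to M and to ΩM. For this direction being Gorenstein projective is weakened to
`IsGorensteinRetract`, which passes to syzygies and cosyzygies without a decomposition theorem for
complexes.

From (iii) to (i): the modules X with top X and τ soc X cyclically black are closed under syzygies,
as top ΩX ≅ τ soc X and τ soc ΩX ≅ γ top X. Conversely write τ soc X ≅ γT with T cyclically black.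
Then X and P(T) have isomorphic socles, so one embeds in the other; as X contains no non-zero
projective, X embeds in P(T), and P(T)/X is again of this kind. Splicing in both directions gives an
exact complex, whose dual is exact by the extension property. -/

theorem IsUniserial.of_injective (h : IsUniserial Λ N) {f : M →ₗ[Λ] N}
    (hf : Function.Injective f) : IsUniserial Λ M := by
  intro A B
  rcases h (A.map f) (B.map f) with h | h
  · exact Or.inl ((Submodule.map_le_map_iff_of_injective hf _ _).mp h)
  · exact Or.inr ((Submodule.map_le_map_iff_of_injective hf _ _).mp h)

theorem IsUniserial.of_surjective (h : IsUniserial Λ M) {f : M →ₗ[Λ] N}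
    (hf : Function.Surjective f) : IsUniserial Λ N := by
  intro A B
  rcases h (A.comap f) (B.comap f) with h | h
  · exact Or.inl ((Submodule.comap_le_comap_iff_of_surjective hf).mp h)
  · exact Or.inr ((Submodule.comap_le_comap_iff_of_surjective hf).mp h)

/-- Nakayama's lemma in uniserial form: proper submodules are superfluous. Together with its dual
(non-zero submodules are essential) it yields most surjectivity and injectivity claims below. -/
theorem IsUniserial.eq_top_of_sup_eq_top (h : IsUniserial Λ M) {A B : Submodule Λ M}
    (hAB : A ⊔ B = ⊤) (hB : B ≠ ⊤) : A = ⊤ := by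
  rcases h A B with h | h
  · exact absurd (sup_eq_right.mpr h ▸ hAB) hB
  · exact sup_eq_left.mpr h ▸ hAB

theorem IsUniserial.eq_bot_of_inf_eq_bot (h : IsUniserial Λ M) {A B : Submodule Λ M}
    (hAB : A ⊓ B = ⊥) (hB : B ≠ ⊥) : A = ⊥ := by
  rcases h A B with h | h
  · exact inf_eq_left.mpr h ▸ hAB
  · exact absurd (inf_eq_right.mpr h ▸ hAB) hB

theorem IsUniserial.isIndecomposable (h : IsUniserial Λ M) [hM : Nontrivial M] :
    IsIndecomposable Λ M := by
  refine ⟨hM, fun A B hAB => ?_⟩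
  by_cases hB : B = ⊥
  · exact Or.inr hB
  · exact Or.inl (h.eq_bot_of_inf_eq_bot hAB.inf_eq_bot hB)

theorem IsUniserial.exists_span_eq_top (h : IsUniserial Λ M) [Module.Finite Λ M] :
    ∃ x : M, Submodule.span Λ {x} = ⊤ := by
  rcases eq_top_or_exists_le_coatom (⊥ : Submodule Λ M) with hbot | ⟨C, hC, -⟩
  · exact ⟨0, by rw [Submodule.span_zero_singleton, hbot]⟩
  · obtain ⟨x, hx⟩ : ∃ x, x ∉ C := by
      by_contra! hall
      exact hC.1 (eq_top_iff.mpr fun x _ => hall x)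
    refine ⟨x, hC.2 _ (lt_of_le_of_ne ?_ ?_)⟩
    · exact (h C _).resolve_right fun hle => hx (hle (Submodule.mem_span_singleton_self x))
    · rintro rfl
      exact hx (Submodule.mem_span_singleton_self x)

theorem IsUniserial.jacobson_eq (h : IsUniserial Λ M) {C : Submodule Λ M} (hC : IsCoatom C) :
    Module.jacobson Λ M = C := by
  refine le_antisymm (sInf_le hC) (le_sInf fun D hD => ?_)
  rcases h C D with hle | hle
  · exact hle
  · exact ((hD.le_iff_eq hC.1).mp hle).le

theorem isCoatom_ker_of_surjective [IsSimpleModule Λ S] {f : M →ₗ[Λ] S}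
    (hf : Function.Surjective f) : IsCoatom (LinearMap.ker f) := by
  rw [← isSimpleModule_iff_isCoatom]
  exact IsSimpleModule.congr (f.quotKerEquivOfSurjective hf)

theorem IsUniserial.nonempty_top_equiv (h : IsUniserial Λ M) [IsSimpleModule Λ S]
    {f : M →ₗ[Λ] S} (hf : Function.Surjective f) : Nonempty (ModuleTop Λ M ≃ₗ[Λ] S) :=
  ⟨(Submodule.quotEquivOfEq _ _ (h.jacobson_eq (isCoatom_ker_of_surjective hf))).trans
    (f.quotKerEquivOfSurjective hf)⟩

theorem IsUniserial.isCoatom_jacobson (h : IsUniserial Λ M) [Module.Finite Λ M] [Nontrivial M] :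
    IsCoatom (Module.jacobson Λ M) := by
  rcases eq_top_or_exists_le_coatom (⊥ : Submodule Λ M) with hbot | ⟨C, hC, -⟩
  · exact absurd hbot bot_ne_top
  · rwa [h.jacobson_eq hC]

theorem IsUniserial.le_jacobson (h : IsUniserial Λ M) [Module.Finite Λ M] {A : Submodule Λ M}
    (hA : A ≠ ⊤) : A ≤ Module.jacobson Λ M := by
  rcases eq_top_or_exists_le_coatom A with hbot | ⟨C, hC, hAC⟩
  · exact absurd hbot hA
  · rwa [h.jacobson_eq hC]

theorem IsUniserial.isSimpleModule_top (h : IsUniserial Λ M) [Module.Finite Λ M]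
    [Nontrivial M] : IsSimpleModule Λ (ModuleTop Λ M) :=
  isSimpleModule_iff_isCoatom.mpr h.isCoatom_jacobson

theorem IsUniserial.nonempty_top_equiv_top (h : IsUniserial Λ M) [Module.Finite Λ M]
    [Nontrivial N] {f : M →ₗ[Λ] N} (hf : Function.Surjective f) :
    Nonempty (ModuleTop Λ M ≃ₗ[Λ] ModuleTop Λ N) := by
  have := Module.Finite.of_surjective f hf
  have := (h.of_surjective hf).isSimpleModule_top
  exact h.nonempty_top_equiv (f := (Module.jacobson Λ N).mkQ ∘ₗ f)
    ((Submodule.mkQ_surjective _).comp hf)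

theorem IsUniserial.socle_eq (h : IsUniserial Λ M) {A : Submodule Λ M}
    (hA : IsSimpleModule Λ A) : socle Λ M = A := by
  refine le_antisymm (sSup_le fun B hB => ?_) (le_sSup hA)
  have hA' := isSimpleModule_iff_isAtom.mp hA
  have hB' := isSimpleModule_iff_isAtom.mp (show IsSimpleModule Λ B from hB)
  rcases h A B with hle | hle
  · exact ((hB'.le_iff_eq hA'.1).mp hle).ge
  · exact hle

theorem IsUniserial.nonempty_socle_equiv (h : IsUniserial Λ M) [IsSimpleModule Λ S]
    {f : S →ₗ[Λ] M} (hf : Function.Injective f) : Nonempty (socle Λ M ≃ₗ[Λ] S) := by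
  have e := LinearEquiv.ofInjective f hf
  have : IsSimpleModule Λ (LinearMap.range f) := IsSimpleModule.congr e.symm
  exact ⟨(LinearEquiv.ofEq _ _ (h.socle_eq this)).trans e.symm⟩

theorem IsUniserial.isSimpleModule_socle (h : IsUniserial Λ M) [IsArtinian Λ M]
    [Nontrivial M] : IsSimpleModule Λ (socle Λ M) := by
  rcases eq_bot_or_exists_atom_le (⊤ : Submodule Λ M) with hbot | ⟨A, hA, -⟩
  · exact absurd hbot top_ne_bot
  · have hA' := isSimpleModule_iff_isAtom.mpr hA
    rw [h.socle_eq hA']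
    exact hA'

theorem IsUniserial.nonempty_socle_equiv_socle (h : IsUniserial Λ N) [IsArtinian Λ N]
    [Nontrivial M] {f : M →ₗ[Λ] N} (hf : Function.Injective f) :
    Nonempty (socle Λ N ≃ₗ[Λ] socle Λ M) := by
  have : IsArtinian Λ M := isArtinian_of_injective f hf
  have := (h.of_injective hf).isSimpleModule_socle
  exact h.nonempty_socle_equiv (f := f ∘ₗ (socle Λ M).subtype)
    (hf.comp (Submodule.injective_subtype _))

end Uniserial

/-- A principal indecomposable module: a finitely generated indecomposable projective module. -/
structure IsPrincipalIndecomposable (Λ : Type u) [Ring Λ] (P : Type u) [AddCommGroup P]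
    [Module Λ P] : Prop where
  finite : Module.Finite Λ P
  projective : Module.Projective Λ P
  indecomposable : IsIndecomposable Λ P

/-! ### Principal indecomposable modules and projective covers -/

section Principal

variable {Λ : Type u} [Ring Λ] {M N P Q : Type u} [AddCommGroup M] [Module Λ M]
  [AddCommGroup N] [Module Λ N] [AddCommGroup P] [Module Λ P] [AddCommGroup Q] [Module Λ Q]

theorem IsPrincipalIndecomposable.nontrivial (hP : IsPrincipalIndecomposable Λ P) :
    Nontrivial P := hP.indecomposable.1

theorem IsPrincipalIndecomposable.uniserial (hP : IsPrincipalIndecomposable Λ P)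
    (hl : IsLeftSerial Λ) : IsUniserial Λ P :=
  hl P hP.finite hP.projective hP.indecomposable

theorem LinearMap.isCompl_range_ker_of_comp_eq_id {s : N →ₗ[Λ] M} {f : M →ₗ[Λ] N}
    (h : f ∘ₗ s = LinearMap.id) : IsCompl (LinearMap.range s) (LinearMap.ker f) := by
  have h' : ∀ y, f (s y) = y := fun y => LinearMap.congr_fun h y
  constructor
  · rw [disjoint_iff, eq_bot_iff]
    rintro _ ⟨⟨y, rfl⟩, hy⟩
    have : y = 0 := by rw [← h' y]; exact hy
    rw [this, map_zero]
    exact Submodule.zero_mem _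
  · rw [codisjoint_iff, eq_top_iff]
    intro x _
    rw [← add_sub_cancel (s (f x)) x]
    refine Submodule.add_mem_sup ⟨f x, rfl⟩ ?_
    rw [LinearMap.mem_ker, map_sub, h', sub_self]

/-- A projective target splits the surjection, and indecomposability kills the complement. This is
how maps between principal indecomposable modules get inverted. -/
theorem IsIndecomposable.bijective_of_surjective (hM : IsIndecomposable Λ M)
    [Module.Projective Λ N] [Nontrivial N] {f : M →ₗ[Λ] N} (hf : Function.Surjective f) :
    Function.Bijective f := by
  obtain ⟨s, hs⟩ := Module.projective_lifting_property f LinearMap.id hf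
  have hs' : ∀ y, f (s y) = y := fun y => LinearMap.congr_fun hs y
  rcases hM.2 (LinearMap.range s) (LinearMap.ker f) 
      (LinearMap.isCompl_range_ker_of_comp_eq_id hs) with h | h
  · exfalso
    obtain ⟨y, hy⟩ := exists_ne (0 : N)
    apply hy
    rw [← hs' y, LinearMap.range_eq_bot.mp h]
    simp
  · exact ⟨LinearMap.ker_eq_bot.mp h, hf⟩

/-- A uniserial quotient of a uniserial module `P` which contains a non-zero projective submodule
is isomorphic to `P`. -/
theorem IsUniserial.bijective_of_injective_of_projective (hP : IsUniserial Λ P)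
    [Module.Projective Λ Q] [Nontrivial Q] {g : P →ₗ[Λ] M} (hg : Function.Surjective g)
    {j : Q →ₗ[Λ] M} (hj : Function.Injective j) : Function.Bijective g := by
  -- The image of the lift `s` is non-zero and meets `ker g` only in 0, because `g ∘ s = j` is
  -- injective.
  obtain ⟨s, hs⟩ := Module.projective_lifting_property g j hg
  have hs' : ∀ y, g (s y) = j y := fun y => LinearMap.congr_fun hs y
  refine ⟨LinearMap.ker_eq_bot.mp (hP.eq_bot_of_inf_eq_bot (B := LinearMap.range s) ?_ ?_), hg⟩
  · rw [eq_bot_iff]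
    rintro _ ⟨hx, y, rfl⟩
    have : j y = 0 := by rw [← hs']; exact hx
    rw [(map_eq_zero_iff j hj).mp this, map_zero]
    exact Submodule.zero_mem _
  · intro h
    obtain ⟨y, hy⟩ := exists_ne (0 : Q)
    apply hy
    apply hj
    rw [← hs', LinearMap.range_eq_bot.mp h]
    simp

/-- The superfluous kernel transfers questions to `M`: a lift of a cyclic generator generates `P`,
and of two complements in `P` one maps onto the uniserial `M`, hence is all of `P`. -/
theorem IsProjectiveCover.isPrincipalIndecomposable {π : P →ₗ[Λ] M} (hπ : IsProjectiveCover π)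
    (hM : IsUniserial Λ M) [Module.Finite Λ M] [Nontrivial M] :
    IsPrincipalIndecomposable Λ P := by
  have hsup : ∀ A : Submodule Λ P, A.map π = ⊤ → A = ⊤ := by
    intro A hA
    apply hπ.superfluous
    have := congrArg (Submodule.comap π) hA
    rwa [Submodule.comap_map_eq, Submodule.comap_top] at this
  refine ⟨?_, hπ.projective, hπ.surjective.nontrivial, fun A B hAB => ?_⟩
  · obtain ⟨x, hx⟩ := hM.exists_span_eq_top
    obtain ⟨p, rfl⟩ := hπ.surjective x
    have : Submodule.span Λ {p} = ⊤ := hsup _ (by rw [Submodule.map_span, Set.image_singleton, hx])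
    exact ⟨⟨{p}, by simpa using this⟩⟩
  · have h1 : A.map π ⊔ B.map π = ⊤ := by
      rw [← Submodule.map_sup, hAB.sup_eq_top, Submodule.map_top,
        LinearMap.range_eq_top.mpr hπ.surjective]
    by_cases hB : B.map π = ⊤
    · left
      have h2 := hAB.inf_eq_bot
      rwa [hsup _ hB, inf_top_eq] at h2
    · right
      have h2 := hAB.inf_eq_bot
      rwa [hsup _ (hM.eq_top_of_sup_eq_top h1 hB), top_inf_eq] at h2

theorem isPrincipalIndecomposable_projCover [IsArtinianRing Λ] (hM : IsUniserial Λ M)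
    [Module.Finite Λ M] [Nontrivial M] : IsPrincipalIndecomposable Λ (ProjCover Λ M) :=
  (isProjectiveCover_projCoverMap Λ M).isPrincipalIndecomposable hM

/-- A cyclic projective module splits off `Λ`. The pair `(i, r)` turns maps into `P` into elements
of right modules `Hom(-, Λ)`. -/
theorem IsPrincipalIndecomposable.exists_retraction (hP : IsPrincipalIndecomposable Λ P)
    (hl : IsLeftSerial Λ) : ∃ (i : P →ₗ[Λ] Λ) (r : Λ →ₗ[Λ] P), r ∘ₗ i = LinearMap.id := by
  have := hP.finite
  have := hP.projective
  obtain ⟨x, hx⟩ := (hP.uniserial hl).exists_span_eq_top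
  have hr : Function.Surjective (LinearMap.toSpanSingleton Λ P x) := by
    rw [← LinearMap.range_eq_top, LinearMap.range_toSpanSingleton, hx]
  obtain ⟨i, hi⟩ := Module.projective_lifting_property _ LinearMap.id hr
  exact ⟨i, _, hi⟩

end Principal

/-! ### Decomposition of the identity of Λ; finiteness of the set of simple modules -/

section Decomposition

variable {Λ : Type u} [Ring Λ] {M : Type u} [AddCommGroup M] [Module Λ M]

theorem isIdempotentElem_projectionOnto_comp {e : Module.End Λ M} (he : IsIdempotentElem e)
    {A B : Submodule Λ (LinearMap.range e)} (hAB : IsCompl A B) :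
    ∃ f : Module.End Λ M, IsIdempotentElem f ∧ LinearMap.range f = A.map (LinearMap.range e).subtype ∧
      ∀ x, f x = A.projection B hAB (e.rangeRestrict x) := by
  have hrr : ∀ y : LinearMap.range e, e.rangeRestrict y = y := by
    rintro ⟨_, x, rfl⟩
    exact Subtype.ext (LinearMap.congr_fun he x)
  refine ⟨(LinearMap.range e).subtype ∘ₗ A.projection B hAB ∘ₗ e.rangeRestrict, ?_, ?_,
    fun x => rfl⟩
  · refine LinearMap.ext fun x => ?_
    simp only [Module.End.mul_apply, LinearMap.comp_apply, Submodule.subtype_apply, hrr]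
    rw [Submodule.projection_apply_of_mem_left _ (Submodule.projection_apply_mem _ _)]
  · rw [LinearMap.range_comp, LinearMap.range_comp, LinearMap.range_rangeRestrict,
      Submodule.map_top, Submodule.range_projection]

/-- An idempotent endomorphism of an artinian module is a sum of idempotents with indecomposable
image. -/
theorem IsIdempotentElem.exists_finset_mem_closure [IsArtinian Λ M] {e : Module.End Λ M}
    (he : IsIdempotentElem e) : ∃ F : Finset (Module.End Λ M),
      (∀ f ∈ F, IsIdempotentElem f ∧ IsIndecomposable Λ (LinearMap.range f)) ∧
      e ∈ AddSubgroup.closure (F : Set (Module.End Λ M)) := by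
  classical
  induction hN : LinearMap.range e using WellFoundedLT.induction generalizing e with
  | _ N ih =>
  subst hN
  by_cases h0 : LinearMap.range e = ⊥
  · refine ⟨∅, by simp, ?_⟩
    rw [LinearMap.range_eq_bot.mp h0]
    exact zero_mem _
  by_cases hi : IsIndecomposable Λ (LinearMap.range e)
  · exact ⟨{e}, by simpa using ⟨he, hi⟩, AddSubgroup.subset_closure (by simp)⟩
  obtain ⟨A, B, hAB, hA, hB⟩ : ∃ A B : Submodule Λ (LinearMap.range e),
      IsCompl A B ∧ A ≠ ⊥ ∧ B ≠ ⊥ := by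
    by_contra! hcon
    refine hi ⟨Submodule.nontrivial_iff_ne_bot.mpr h0, fun A B hAB => ?_⟩
    exact or_iff_not_imp_left.mpr fun hA => hcon A B hAB hA
  have hlt : ∀ C : Submodule Λ (LinearMap.range e), C ≠ ⊤ →
      C.map (LinearMap.range e).subtype < LinearMap.range e := by
    intro C hC
    refine lt_of_le_of_ne (Submodule.map_subtype_le _ _) fun h => hC ?_
    apply Submodule.map_injective_of_injective (Submodule.injective_subtype (LinearMap.range e))
    rw [h, Submodule.map_top, Submodule.range_subtype]
  have hA' : A ≠ ⊤ := by
    rintro rfl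
    exact hB (by simpa using hAB.inf_eq_bot)
  have hB' : B ≠ ⊤ := by
    rintro rfl
    exact hA (by simpa using hAB.inf_eq_bot)
  obtain ⟨f, hf, hfr, hfx⟩ := isIdempotentElem_projectionOnto_comp he hAB
  obtain ⟨g, hg, hgr, hgx⟩ := isIdempotentElem_projectionOnto_comp he hAB.symm
  obtain ⟨F, hF, hfF⟩ := ih _ (hfr ▸ hlt A hA') hf rfl
  obtain ⟨G, hG, hgG⟩ := ih _ (hgr ▸ hlt B hB') hg rfl
  refine ⟨F ∪ G, fun x hx => (Finset.mem_union.mp hx).elim (hF x) (hG x), ?_⟩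
  have hsum : e = f + g := by
    refine LinearMap.ext fun x => ?_
    rw [LinearMap.add_apply, hfx, hgx, ← Submodule.coe_add,
      Submodule.projection_add_projection_eq_self]
    rfl
  rw [hsum]
  exact add_mem (AddSubgroup.closure_mono (by simp) hfF) (AddSubgroup.closure_mono (by simp) hgG)

theorem isPrincipalIndecomposable_range {e : Module.End Λ Λ} (he : IsIdempotentElem e)
    (hi : IsIndecomposable Λ (LinearMap.range e)) :
    IsPrincipalIndecomposable Λ (LinearMap.range e) := by
  refine ⟨Module.Finite.range e, Module.Projective.of_split (LinearMap.range e).subtype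
    e.rangeRestrict ?_, hi⟩
  refine LinearMap.ext ?_
  rintro ⟨_, x, rfl⟩
  exact Subtype.ext (LinearMap.congr_fun he x)

/-- The identity of `Λ` is a sum of finitely many idempotents whose images are principal
indecomposable modules. -/
theorem exists_finset_principal (Λ : Type u) [Ring Λ] [IsArtinianRing Λ] :
    ∃ F : Finset (Module.End Λ Λ),
      (∀ e ∈ F, IsPrincipalIndecomposable Λ (LinearMap.range e)) ∧
      LinearMap.id ∈ AddSubgroup.closure (F : Set (Module.End Λ Λ)) := by
  obtain ⟨F, hF, h⟩ := IsIdempotentElem.exists_finset_mem_closure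
    (e := (1 : Module.End Λ Λ)) (mul_one 1)
  exact ⟨F, fun e he => isPrincipalIndecomposable_range (hF e he).1 (hF e he).2, h⟩

theorem exists_mem_finset_notMem {F : Finset (Module.End Λ Λ)}
    (hF : LinearMap.id ∈ AddSubgroup.closure (F : Set (Module.End Λ Λ)))
    {N : Submodule Λ M} {x : M} (hx : x ∉ N) :
    ∃ e ∈ F, ∃ f : LinearMap.range e →ₗ[Λ] M, ¬ LinearMap.range f ≤ N := by
  by_contra! h
  apply hx
  -- The element `x` is the image of 1 under `c ↦ c • x`, and 1 is an integral combination of the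
  -- elements `e 1` with `e ∈ F`.
  have key : ∀ e ∈ AddSubgroup.closure (F : Set (Module.End Λ Λ)),
      LinearMap.toSpanSingleton Λ M x (e 1) ∈ N := by
    intro e he
    induction he using AddSubgroup.closure_induction with
    | mem e he =>
      exact h e he (LinearMap.toSpanSingleton Λ M x ∘ₗ (LinearMap.range e).subtype)
        ⟨⟨e 1, 1, rfl⟩, rfl⟩
    | zero => simp
    | add a b _ _ ha hb => rw [LinearMap.add_apply, map_add]; exact N.add_mem ha hb
    | neg a _ ha => rw [LinearMap.neg_apply, map_neg]; exact N.neg_mem ha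
  simpa using key _ hF

theorem exists_principal_hom [IsArtinianRing Λ] {N : Submodule Λ M} {x : M} (hx : x ∉ N) :
    ∃ (P : ModuleCat.{u} Λ) (f : P →ₗ[Λ] M), IsPrincipalIndecomposable Λ P ∧
      ¬ LinearMap.range f ≤ N := by
  obtain ⟨F, hF, h⟩ := exists_finset_principal Λ
  obtain ⟨e, he, f, hf⟩ := exists_mem_finset_notMem h hx
  exact ⟨ModuleCat.of Λ (LinearMap.range e), f, hF e he, hf⟩

/-- As `g = id ∘ g` is an integral combination of maps `e ∘ g`, additive statements on maps to `Λ`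
reduce to maps through principal indecomposable modules. -/
theorem mem_of_principal_retracts [IsArtinianRing Λ] (W : AddSubgroup (M →ₗ[Λ] Λ))
    (g : M →ₗ[Λ] Λ)
    (h : ∀ (A : ModuleCat.{u} Λ) (r : Λ →ₗ[Λ] A) (i : A →ₗ[Λ] Λ),
      IsPrincipalIndecomposable Λ A → i ∘ₗ r ∘ₗ g ∈ W) : g ∈ W := by
  obtain ⟨F, hF, hid⟩ := exists_finset_principal Λ
  have key : ∀ e ∈ AddSubgroup.closure (F : Set (Module.End Λ Λ)), e ∘ₗ g ∈ W := by
    intro e he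
    induction he using AddSubgroup.closure_induction with
    | mem e he =>
      exact h (ModuleCat.of Λ (LinearMap.range e)) e.rangeRestrict (LinearMap.range e).subtype
        (hF e he)
    | zero => rw [LinearMap.zero_comp]; exact W.zero_mem
    | add a b _ _ ha hb => rw [LinearMap.add_comp]; exact W.add_mem ha hb
    | neg a _ ha => rw [LinearMap.neg_comp]; exact W.neg_mem ha
  exact key _ hid

/-- There are only finitely many simple modules up to isomorphism. -/
theorem exists_lt_nonempty_equiv_of_isSimpleModule [IsArtinianRing Λ] (hl : IsLeftSerial Λ)
    (T : ℕ → ModuleCat.{u} Λ) (hT : ∀ k, IsSimpleModule Λ (T k)) :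
    ∃ i j, i < j ∧ Nonempty (T i ≃ₗ[Λ] T j) := by
  obtain ⟨F, hF, h⟩ := exists_finset_principal Λ
  have hex : ∀ k, ∃ e : F, ∃ f : LinearMap.range e.1 →ₗ[Λ] T k, Function.Surjective f := by
    intro k
    have := hT k
    have := IsSimpleModule.nontrivial Λ (T k)
    obtain ⟨x, hx⟩ := exists_ne (0 : T k)
    obtain ⟨e, he, f, hf⟩ := exists_mem_finset_notMem (N := ⊥) h (by simpa using hx)
    refine ⟨⟨e, he⟩, f, f.surjective_of_ne_zero ?_⟩
    rintro rfl
    simp at hf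
  choose e f hf using hex
  obtain ⟨i, j, hne, heq⟩ := Finite.exists_ne_map_eq_of_infinite e
  -- A simple quotient of a uniserial module is its top, so the index `e k` determines `T k`.
  have htop : ∀ k, Nonempty (ModuleTop Λ (LinearMap.range (e k).1) ≃ₗ[Λ] T k) := fun k =>
    have := hT k
    ((hF _ (e k).2).uniserial hl).nonempty_top_equiv (hf k)
  have hiso : ∀ i j, e i = e j → Nonempty (T i ≃ₗ[Λ] T j) := by
    intro i j heq
    obtain ⟨a⟩ := htop i
    obtain ⟨b⟩ := htop j
    rw [heq] at a
    exact ⟨a.symm.trans b⟩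
  rcases lt_or_gt_of_ne hne with hlt | hlt
  · exact ⟨i, j, hlt, hiso i j heq⟩
  · exact ⟨j, i, hlt, hiso j i heq.symm⟩

end Decomposition

/-! ### Duals of principal indecomposable modules and the factorization property -/

section RightSerial

variable {Λ : Type u} [Ring Λ] {P A B : Type u} [AddCommGroup P] [Module Λ P]
  [AddCommGroup A] [Module Λ A] [AddCommGroup B] [Module Λ B]

/-- The split embedding `i` generates `Hom(P, Λ)`. The projection belonging to a decomposition is
therefore composition with an idempotent `ψ` of `P`, whose image or kernel must vanish. -/
theorem IsPrincipalIndecomposable.dual (hP : IsPrincipalIndecomposable Λ P)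
    (hl : IsLeftSerial Λ) : IsPrincipalIndecomposable Λᵐᵒᵖ (P →ₗ[Λ] Λ) := by
  obtain ⟨i, r, hri⟩ := hP.exists_retraction hl
  have hri' : ∀ p, r (i p) = p := fun p => LinearMap.congr_fun hri p
  have hr : ∀ c : Λ, r c = c • r 1 := fun c => by rw [← map_smul, smul_eq_mul, mul_one]
  have hgen : ∀ f : P →ₗ[Λ] Λ, MulOpposite.op (f (r 1)) • i = f := by
    intro f
    refine LinearMap.ext fun p => ?_
    change i p * f (r 1) = f p
    rw [← smul_eq_mul, ← map_smul, ← hr, hri']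
  have := hP.nontrivial
  let α : Λᵐᵒᵖ →ₗ[Λᵐᵒᵖ] (P →ₗ[Λ] Λ) := LinearMap.toSpanSingleton Λᵐᵒᵖ _ i
  let β : (P →ₗ[Λ] Λ) →ₗ[Λᵐᵒᵖ] Λᵐᵒᵖ :=
    { toFun := fun f => MulOpposite.op (f (r 1))
      map_add' := fun f g => rfl
      map_smul' := fun c f => rfl }
  have hαβ : α ∘ₗ β = LinearMap.id := LinearMap.ext hgen
  refine ⟨Module.Finite.of_surjective α fun f => ⟨β f, hgen f⟩,
    Module.Projective.of_split β α hαβ, ?_, ?_⟩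
  · refine ⟨i, 0, ?_⟩
    rintro rfl
    obtain ⟨p, hp⟩ := exists_ne (0 : P)
    exact hp (by rw [← hri' p]; simp)
  intro A B hAB
  let φ := A.projection B hAB
  let ψ : P →ₗ[Λ] P := r ∘ₗ φ i
  have hφ : ∀ f, φ f = f ∘ₗ ψ := by
    intro f
    conv_lhs => rw [← hgen f, map_smul]
    refine LinearMap.ext fun p => ?_
    change φ i p * f (r 1) = f (r (φ i p))
    rw [hr (φ i p), map_smul, smul_eq_mul]
  have hφφ : ∀ f, φ (φ f) = φ f := fun f =>
    Submodule.projection_apply_of_mem_left hAB (Submodule.projection_apply_mem hAB f)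
  have hψ : IsIdempotentElem (M := Module.End Λ P) ψ := by
    change ψ ∘ₗ ψ = ψ
    conv_lhs => rw [show ψ = r ∘ₗ φ i from rfl, LinearMap.comp_assoc]
    rw [show φ i ∘ₗ r ∘ₗ φ i = φ (φ i) from (hφ (φ i)).symm, hφφ]
  rcases hP.indecomposable.2 _ _ (LinearMap.IsIdempotentElem.isCompl hψ) with h | h
  · left
    rw [eq_bot_iff]
    intro f hf
    have h1 : φ f = f := Submodule.projection_apply_of_mem_left hAB hf
    rw [hφ, LinearMap.range_eq_bot.mp h, LinearMap.comp_zero] at h1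
    exact h1.symm
  · right
    rw [eq_bot_iff]
    intro f hf
    have h1 : φ f = 0 := (Submodule.projection_apply_eq_zero_iff hAB).mpr hf
    rw [hφ] at h1
    have h2 : ∀ p, ψ p = p := fun p => by
      apply LinearMap.ker_eq_bot.mp h
      exact LinearMap.congr_fun hψ p
    refine LinearMap.ext fun p => ?_
    rw [← h2 p]
    exact LinearMap.congr_fun h1 p

theorem IsPrincipalIndecomposable.isUniserial_dual (hP : IsPrincipalIndecomposable Λ P)
    (hl : IsLeftSerial Λ) (hr : IsLeftSerial Λᵐᵒᵖ) : IsUniserial Λᵐᵒᵖ (P →ₗ[Λ] Λ) :=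
  (hP.dual hl).uniserial hr

/-- The right action on `Hom(P, Λ)` is composition with right multiplications of `Λ`, so
divisibility in this right module is factorization of maps. -/
theorem exists_comp_eq_of_mem_span {a b : P →ₗ[Λ] Λ} (h : a ∈ Submodule.span Λᵐᵒᵖ {b}) :
    ∃ h : Λ →ₗ[Λ] Λ, a = h ∘ₗ b := by
  obtain ⟨c, rfl⟩ := Submodule.mem_span_singleton.mp h
  exact ⟨LinearMap.toSpanSingleton Λ Λ c.unop, rfl⟩

/-- Of two maps from a principal indecomposable module to principal indecomposable modules, one
factors through the other. -/
theorem IsPrincipalIndecomposable.exists_eq_comp_or (hP : IsPrincipalIndecomposable Λ P)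
    (hA : IsPrincipalIndecomposable Λ A) (hB : IsPrincipalIndecomposable Λ B)
    (hl : IsLeftSerial Λ) (hr : IsLeftSerial Λᵐᵒᵖ) (a : P →ₗ[Λ] A) (b : P →ₗ[Λ] B) :
    (∃ h : B →ₗ[Λ] A, a = h ∘ₗ b) ∨ ∃ h : A →ₗ[Λ] B, b = h ∘ₗ a := by
  obtain ⟨i, r, hri⟩ := hA.exists_retraction hl
  obtain ⟨j, s, hsj⟩ := hB.exists_retraction hl
  have hi : a = r ∘ₗ i ∘ₗ a := by rw [← LinearMap.comp_assoc, hri, LinearMap.id_comp]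
  have hj : b = s ∘ₗ j ∘ₗ b := by rw [← LinearMap.comp_assoc, hsj, LinearMap.id_comp]
  -- With `A` and `B` embedded as summands of `Λ`, both maps lie in one uniserial right module,
  -- where cyclic submodules are comparable.
  rcases hP.isUniserial_dual hl hr (Submodule.span Λᵐᵒᵖ {i ∘ₗ a})
    (Submodule.span Λᵐᵒᵖ {j ∘ₗ b}) with h | h
  · obtain ⟨h, hh⟩ := exists_comp_eq_of_mem_span (h (Submodule.mem_span_singleton_self _))
    exact Or.inl ⟨r ∘ₗ h ∘ₗ j, hi.trans (congrArg (r ∘ₗ ·) hh)⟩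
  · obtain ⟨h, hh⟩ := exists_comp_eq_of_mem_span (h (Submodule.mem_span_singleton_self _))
    exact Or.inr ⟨s ∘ₗ h ∘ₗ i, hj.trans (congrArg (s ∘ₗ ·) hh)⟩

end RightSerial

/-! ### Indecomposable modules are uniserial -/

section Indecomposable

variable {Λ : Type u} [Ring Λ] {M P : Type u} [AddCommGroup M] [Module Λ M]
  [AddCommGroup P] [Module Λ P]

theorem Submodule.length_lt_length [IsArtinian Λ M] [IsNoetherian Λ M] {A B : Submodule Λ M}
    (h : A < B) : Module.length Λ A < Module.length Λ B := by
  rw [Module.length_submodule, Module.length_submodule]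
  exact Submodule.height_strictMono h

theorem length_range_le_of_ker_le {N : Type u} [AddCommGroup N] [Module Λ N] {f : P →ₗ[Λ] M}
    {g : P →ₗ[Λ] N} (h : LinearMap.ker f ≤ LinearMap.ker g) :
    Module.length Λ (LinearMap.range g) ≤ Module.length Λ (LinearMap.range f) := by
  rw [← f.quotKerEquivRange.length_eq, ← g.quotKerEquivRange.length_eq]
  exact Module.length_le_of_surjective _ (Submodule.factor_surjective h)

theorem exists_principal_hom_maximal_length [IsArtinianRing Λ] [Module.Finite Λ M]
    [Nontrivial M] : ∃ (P : ModuleCat.{u} Λ) (f : P →ₗ[Λ] M), IsPrincipalIndecomposable Λ P ∧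
      LinearMap.range f ≠ ⊥ ∧ ∀ (Q : ModuleCat.{u} Λ) (g : Q →ₗ[Λ] M),
        IsPrincipalIndecomposable Λ Q →
        Module.length Λ (LinearMap.range g) ≤ Module.length Λ (LinearMap.range f) := by
  let s : Set (Submodule Λ M) := {U | ∃ (P : ModuleCat.{u} Λ) (f : P →ₗ[Λ] M),
    IsPrincipalIndecomposable Λ P ∧ U = LinearMap.range f}
  obtain ⟨x, hx⟩ := exists_ne (0 : M)
  obtain ⟨P₀, f₀, hP₀, hf₀⟩ := exists_principal_hom (N := (⊥ : Submodule Λ M))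
    (by simpa using hx)
  let ν : Submodule Λ M → ℕ := fun U => (Module.length Λ U).toNat
  have hν : ∀ U : Submodule Λ M, ((ν U : ℕ) : ℕ∞) = Module.length Λ U := fun U =>
    ENat.natCast_toNat Module.length_ne_top
  have hbdd : BddAbove (ν '' s) := by
    refine ⟨ν ⊤, ?_⟩
    rintro _ ⟨U, -, rfl⟩
    rw [← Nat.cast_le (α := ℕ∞), hν, hν, Module.length_top]
    exact Module.length_le_of_injective U.subtype U.injective_subtype
  obtain ⟨U, ⟨P, f, hP, rfl⟩, hU⟩ := Nat.sSup_mem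
    (Set.Nonempty.image ν (⟨_, P₀, f₀, hP₀, rfl⟩ : s.Nonempty)) hbdd
  have hmax : ∀ (Q : ModuleCat.{u} Λ) (g : Q →ₗ[Λ] M), IsPrincipalIndecomposable Λ Q →
      Module.length Λ (LinearMap.range g) ≤ Module.length Λ (LinearMap.range f) := by
    intro Q g hQ
    rw [← hν, ← hν, Nat.cast_le, hU]
    exact le_csSup hbdd ⟨_, ⟨Q, g, hQ, rfl⟩, rfl⟩
  refine ⟨P, f, hP, fun h => ?_, hmax⟩
  have h1 := hmax P₀ f₀ hP₀
  rw [h, Module.length_bot, nonpos_iff_eq_zero, Module.length_eq_zero_iff,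
    Submodule.subsingleton_iff_eq_bot] at h1
  exact hf₀ h1.le

/-- Over an artinian serial ring, a uniserial submodule of maximal length is complemented. -/
theorem exists_isCompl_range_of_maximal_length [IsArtinianRing Λ] (hl : IsLeftSerial Λ)
    (hr : IsLeftSerial Λᵐᵒᵖ) [Module.Finite Λ M] (hP : IsPrincipalIndecomposable Λ P)
    (f : P →ₗ[Λ] M)
    (hmax : ∀ (Q : ModuleCat.{u} Λ) (g : Q →ₗ[Λ] M), IsPrincipalIndecomposable Λ Q →
      Module.length Λ (LinearMap.range g) ≤ Module.length Λ (LinearMap.range f)) :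
    ∃ C : Submodule Λ M, IsCompl C (LinearMap.range f) := by
  -- `C` is maximal with zero intersection with the image of `f`. If the sum is not `M`, take `y : Q
  -- → M` not landing in it and let `K` be the preimage of the sum. A map `g` into the image of `f`
  -- that agrees with `y` modulo `C` on `K` suffices: `C + im (y - g)` still meets the image of `f`
  -- trivially.
  obtain ⟨C, hC, hCmax⟩ := WellFounded.has_min
    (wellFounded_gt : WellFounded (fun A B : Submodule Λ M => A > B))
    {C | C ⊓ LinearMap.range f = ⊥} ⟨⊤ ⊓ ⊥, by simp⟩
  have hC' : C ⊓ LinearMap.range f = ⊥ := hC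
  have hCf : ∀ p, f p ∈ C → f p = 0 := by
    intro p hp
    have : f p ∈ C ⊓ LinearMap.range f := ⟨hp, p, rfl⟩
    rwa [hC'] at this
  refine ⟨C, disjoint_iff.mpr hC', codisjoint_iff.mpr ?_⟩
  by_contra hne
  obtain ⟨x, hx⟩ : ∃ x, x ∉ C ⊔ LinearMap.range f := by
    by_contra! hall
    exact hne (eq_top_iff.mpr fun x _ => hall x)
  obtain ⟨Q, y, hQ, hy⟩ := exists_principal_hom hx
  have hQu := hQ.uniserial hl
  have := hQ.finite
  have := hP.finite
  have := hP.nontrivial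
  have := hQ.nontrivial
  have := hP.projective
  have := hQ.projective
  let K := (C ⊔ LinearMap.range f).comap y
  have hK : K ≠ ⊤ := by
    intro h
    apply hy
    rintro _ ⟨q, rfl⟩
    exact (h ▸ Submodule.mem_top : q ∈ K)
  obtain ⟨g, hgf, hgC⟩ : ∃ g : Q →ₗ[Λ] M, LinearMap.range g ≤ LinearMap.range f ∧
      ∀ q ∈ K, y q - g q ∈ C := by
    by_cases hK0 : K = ⊥
    · refine ⟨0, by simp, fun q hq => ?_⟩
      rw [hK0, Submodule.mem_bot] at hq
      simp [hq]
    have : Nontrivial K := Submodule.nontrivial_iff_ne_bot.mpr hK0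
    have hKu : IsUniserial Λ K := hQu.of_injective K.injective_subtype
    let a : ProjCover Λ K →ₗ[Λ] Q := K.subtype ∘ₗ projCoverMap Λ K
    have hcov := isProjectiveCover_projCoverMap Λ K
    have hR := isPrincipalIndecomposable_projCover hKu
    have ha : ∀ q ∈ K, ∃ z, a z = q := by
      intro q hq
      obtain ⟨z, hz⟩ := hcov.surjective ⟨q, hq⟩
      exact ⟨z, congrArg Subtype.val hz⟩
    have ha' : ∀ z, a z ∈ K := fun z => (projCoverMap Λ K z).2
    let f' : P →ₗ[Λ] M ⧸ C := C.mkQ ∘ₗ f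
    let c : ProjCover Λ K →ₗ[Λ] LinearMap.range f' :=
      (C.mkQ ∘ₗ y ∘ₗ a).codRestrict _ (by
        intro z
        obtain ⟨u, hu, v, ⟨p, rfl⟩, huv⟩ := Submodule.mem_sup.mp (ha' z)
        refine ⟨p, ?_⟩
        change C.mkQ (f p) = C.mkQ (y (a z))
        rw [← huv, map_add, (show C.mkQ u = 0 by simpa using hu), zero_add])
    have := hR.projective
    -- `b` lifts the component in the image of `f`: the maps `y ∘ a` and `f ∘ b` agree modulo `C`.
    obtain ⟨b, hb⟩ := Module.projective_lifting_property f'.rangeRestrict c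
      f'.surjective_rangeRestrict
    have hb' : ∀ z, y (a z) - f (b z) ∈ C := by
      intro z
      have h1 : C.mkQ (f (b z)) = C.mkQ (y (a z)) :=
        congrArg Subtype.val (LinearMap.congr_fun hb z)
      rw [← Submodule.ker_mkQ C, LinearMap.mem_ker, map_sub, h1, sub_self]
    have hfac : ∀ h : Q →ₗ[Λ] P, b = h ∘ₗ a → ∃ g : Q →ₗ[Λ] M,
        LinearMap.range g ≤ LinearMap.range f ∧ ∀ q ∈ K, y q - g q ∈ C := by
      intro h hh
      refine ⟨f ∘ₗ h, LinearMap.range_comp_le_range _ _, fun q hq => ?_⟩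
      obtain ⟨z, rfl⟩ := ha q hq
      have := hb' z
      rwa [hh] at this
    rcases hR.exists_eq_comp_or hP hQ hl hr b a with ⟨h, hh⟩ | ⟨h, hh⟩
    · exact hfac h hh
    by_cases hsurj : Function.Surjective h
    · let e := LinearEquiv.ofBijective h (hP.indecomposable.bijective_of_surjective hsurj)
      refine hfac e.symm.toLinearMap ?_
      refine LinearMap.ext fun z => ?_
      rw [hh]
      exact (e.symm_apply_apply (b z)).symm
    by_cases hfb : ∀ z, f (b z) = 0
    · refine ⟨0, by simp, fun q hq => ?_⟩
      obtain ⟨z, rfl⟩ := ha q hq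
      simpa [hfb] using hb' z
    -- Here `a = h ∘ b` with `h` not surjective. Then `ker (y ∘ h) ≤ ker f`, so the image of `y ∘ h`
    -- is at least as long as that of `f`, yet it is properly contained in the image of `y`,
    -- contrary to `hmax`.
    exfalso
    have hAB : LinearMap.range b ⊓ LinearMap.ker (y ∘ₗ h) ≤ LinearMap.ker f := by
      rintro _ ⟨⟨z, rfl⟩, hz⟩
      apply hCf
      have h1 : y (a z) = 0 := by rw [hh]; exact hz
      have h2 := hb' z
      rw [h1, zero_sub] at h2
      exact neg_mem_iff.mp h2
    have hker : LinearMap.ker (y ∘ₗ h) ≤ LinearMap.ker f := by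
      rcases hP.uniserial hl (LinearMap.range b) (LinearMap.ker (y ∘ₗ h)) with hle | hle
      · rw [inf_eq_left.mpr hle] at hAB
        exact absurd (fun z => hAB ⟨z, rfl⟩) hfb
      · rwa [inf_eq_right.mpr hle] at hAB
    have hlt : LinearMap.range (y ∘ₗ h) < LinearMap.range y := by
      refine lt_of_le_of_ne (LinearMap.range_comp_le_range _ _) fun heq => hsurj ?_
      rw [← LinearMap.range_eq_top]
      refine hQu.eq_top_of_sup_eq_top (B := K) (eq_top_iff.mpr fun q _ => ?_) hK
      obtain ⟨p, hp⟩ : y q ∈ LinearMap.range (y ∘ₗ h) := heq ▸ ⟨q, rfl⟩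
      rw [← add_sub_cancel (h p) q]
      refine Submodule.add_mem_sup ⟨p, rfl⟩ ?_
      have : y (q - h p) = 0 := by rw [map_sub, ← hp]; exact sub_self _
      change y (q - h p) ∈ C ⊔ LinearMap.range f
      rw [this]
      exact zero_mem _
    exact absurd ((Submodule.length_lt_length hlt).trans_le (hmax Q y hQ))
      (length_range_le_of_ker_le hker).not_gt
  let C' := C ⊔ LinearMap.range (y - g)
  have hC'' : C' ⊓ LinearMap.range f = ⊥ := by
    rw [eq_bot_iff]
    rintro v ⟨hv, hvf⟩
    obtain ⟨c, hc, _, ⟨q, rfl⟩, rfl⟩ := Submodule.mem_sup.mp hv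
    have hq : q ∈ K := by
      have h1 : y q = -c + ((c + (y - g) q) + g q) := by
        rw [LinearMap.sub_apply]; abel
      change y q ∈ C ⊔ LinearMap.range f
      rw [h1]
      exact Submodule.add_mem_sup (neg_mem hc) (add_mem hvf (hgf ⟨q, rfl⟩))
    rw [← hC']
    exact ⟨add_mem hc (hgC q hq), hvf⟩
  have hCC : C' = C := by
    by_contra hcon
    exact hCmax C' hC'' (lt_of_le_of_ne le_sup_left (Ne.symm hcon))
  apply hy
  rintro _ ⟨q, rfl⟩
  rw [← sub_add_cancel (y q) (g q)]
  refine Submodule.add_mem_sup ?_ (hgf ⟨q, rfl⟩)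
  rw [← hCC]
  exact Submodule.mem_sup_right ⟨q, rfl⟩

theorem IsIndecomposable.isUniserial [IsArtinianRing Λ] (hl : IsLeftSerial Λ)
    (hr : IsLeftSerial Λᵐᵒᵖ) [Module.Finite Λ M] (hM : IsIndecomposable Λ M) :
    IsUniserial Λ M := by
  have := hM.1
  obtain ⟨P, f, hP, hf, hmax⟩ := exists_principal_hom_maximal_length (Λ := Λ) (M := M)
  obtain ⟨C, hC⟩ := exists_isCompl_range_of_maximal_length hl hr hP f hmax
  have hCbot := (hM.2 _ _ hC).resolve_right hf
  refine (hP.uniserial hl).of_surjective (f := f) (LinearMap.range_eq_top.mp ?_)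
  simpa [hCbot] using hC.sup_eq_top

end Indecomposable

/-! ### The injective cogenerator and duals of simple modules -/

section Duality

variable {R : Type u} [CommRing R]

theorem Module.Injective.exists_comp_eq_of_ker_le {R : Type u} [Ring R] {A B E : Type u}
    [AddCommGroup A] [Module R A]
    [AddCommGroup B] [Module R B] [AddCommGroup E] [Module R E] (hE : Module.Injective R E)
    (T : A →ₗ[R] B) (g : A →ₗ[R] E) (h : LinearMap.ker T ≤ LinearMap.ker g) :
    ∃ φ : B →ₗ[R] E, ∀ a, φ (T a) = g a := by
  obtain ⟨φ, hφ⟩ := hE.out ((LinearMap.ker T).liftQ T le_rfl)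
    (by rw [← LinearMap.ker_eq_bot]; exact Submodule.ker_liftQ_eq_bot' _ _ rfl)
    ((LinearMap.ker T).liftQ g h)
  exact ⟨φ, fun a => hφ (Submodule.Quotient.mk a)⟩

/-- The embedding of `R / rad R` into its injective envelope. -/
noncomputable def dualizingEmbedding (R : Type u) [CommRing R] :
    (R ⧸ Ring.jacobson R) →ₗ[R] dualizingModule R :=
  (exists_isInjectiveEnvelope R (R ⧸ Ring.jacobson R)).choose.2

theorem isInjectiveEnvelope_dualizingEmbedding (R : Type u) [CommRing R] :
    IsInjectiveEnvelope (dualizingEmbedding R) :=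
  (exists_isInjectiveEnvelope R (R ⧸ Ring.jacobson R)).choose_spec

theorem Ring.mem_jacobson_of_sq_mem {a : R} (h : a * a ∈ Ring.jacobson R) :
    a ∈ Ring.jacobson R := by
  refine Submodule.mem_sInf.mpr fun m hm => ?_
  have hm' : Ideal.IsMaximal m := Ideal.isMaximal_def.mpr hm
  have h1 : a * a ∈ m := (sInf_le hm : Ring.jacobson R ≤ m) h
  exact (hm'.isPrime.mem_or_mem h1).elim id id

/-- The annihilator of `x` lies in a maximal ideal `m`, and `R / m` is a summand of the semisimple
module `R / rad R`, which embeds in `E`. The resulting map `R → E` killing `m` factors through `c ↦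
c • x` and extends to `X` by injectivity. -/
theorem exists_dualizingModule_apply_ne_zero [IsArtinianRing R] {X : Type u} [AddCommGroup X]
    [Module R X] {x : X} (hx : x ≠ 0) : ∃ φ : X →ₗ[R] dualizingModule R, φ x ≠ 0 := by
  have hE := isInjectiveEnvelope_dualizingEmbedding R
  let T := LinearMap.toSpanSingleton R X x
  have hT : (LinearMap.ker T : Ideal R) ≠ ⊤ := by
    intro h
    have h1 : (1 : R) ∈ LinearMap.ker T := h ▸ Submodule.mem_top
    exact hx (by simpa [T] using h1)
  obtain ⟨m, hm, hTm⟩ := Ideal.exists_le_maximal _ hT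
  have hss : IsSemisimpleModule R (R ⧸ Ring.jacobson R) := by
    have := (inferInstance : IsSemiprimaryRing R).isSemisimpleRing
    let l : (R ⧸ Ring.jacobson R) →ₛₗ[Ideal.Quotient.mk (Ring.jacobson R)]
        (R ⧸ Ring.jacobson R) :=
      { toFun := id
        map_add' := fun _ _ => rfl
        map_smul' := fun a x => Quotient.inductionOn' x fun _ => rfl }
    have : RingHomSurjective (Ideal.Quotient.mk (Ring.jacobson R)) :=
      ⟨Ideal.Quotient.mk_surjective⟩
    exact (LinearMap.isSemisimpleModule_iff_of_bijective l Function.bijective_id).mpr ‹_›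
  let m' : Submodule R (R ⧸ Ring.jacobson R) := Submodule.map (Submodule.mkQ (Ring.jacobson R)) m
  obtain ⟨C, hC⟩ := exists_isCompl m'
  let f : R →ₗ[R] (R ⧸ Ring.jacobson R) := C.projection m' hC.symm ∘ₗ Submodule.mkQ _
  have hf : ∀ a ∈ m, f a = 0 := fun a ha =>
    (Submodule.projection_apply_eq_zero_iff hC.symm).mpr ⟨a, ha, rfl⟩
  have hf1 : f 1 ≠ 0 := by
    intro h
    obtain ⟨a, ha, ha'⟩ := (Submodule.projection_apply_eq_zero_iff hC.symm).mp h
    have h1 : a - 1 ∈ Ring.jacobson R := (Submodule.Quotient.eq _).mp ha'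
    have h2 := m.sub_mem ha (Ring.jacobson_le_of_isMaximal m h1)
    rw [sub_sub_cancel] at h2
    exact hm.ne_top ((Ideal.eq_top_iff_one m).mpr h2)
  obtain ⟨φ, hφ⟩ := hE.injective_module.exists_comp_eq_of_ker_le T (dualizingEmbedding R ∘ₗ f)
    (fun a ha => by rw [LinearMap.mem_ker, LinearMap.comp_apply, hf a (hTm ha), map_zero])
  refine ⟨φ, fun h => hf1 (hE.injective ?_)⟩
  rw [map_zero, ← h, ← LinearMap.comp_apply, ← hφ 1]
  simp [T]

/-- The `m`-torsion of `E` is at most one-dimensional over `R / m`. By essentiality it lies in `R /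
rad R`. There a torsion class represented by `a ∈ m` has `a * a ∈ rad R` and so vanishes; hence a
non-zero one has a representative invertible modulo `m`. -/
theorem exists_smul_eq_of_forall_smul_eq_zero {m : Ideal R} (hm : m.IsMaximal)
    {s t : dualizingModule R} (hs : ∀ a ∈ m, a • s = 0) (ht : ∀ a ∈ m, a • t = 0) (ht0 : t ≠ 0) :
    ∃ c : R, s = c • t := by
  have hE := isInjectiveEnvelope_dualizingEmbedding R
  have hrange : ∀ t : dualizingModule R, (∀ a ∈ m, a • t = 0) →
      t ∈ LinearMap.range (dualizingEmbedding R) := by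
    intro t ht
    by_cases ht0 : t = 0
    · rw [ht0]; exact zero_mem _
    have h1 : Submodule.span R {t} ⊓ LinearMap.range (dualizingEmbedding R) ≠ ⊥ := fun h =>
      ht0 (Submodule.span_singleton_eq_bot.mp (hE.essential _ h))
    obtain ⟨v, ⟨hv, hvr⟩, hv0⟩ := Submodule.exists_mem_ne_zero_of_ne_bot h1
    obtain ⟨c, rfl⟩ := Submodule.mem_span_singleton.mp hv
    obtain ⟨d, i, hi, hd⟩ := hm.exists_inv (x := c) (fun hc => hv0 (ht c hc))
    have h2 : t = d • c • t := by
      conv_lhs => rw [← one_smul R t, ← hd, add_smul, ht i hi, add_zero, mul_smul]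
    rw [h2]
    exact Submodule.smul_mem _ d hvr
  have hker : ∀ b : R, (∀ a ∈ m, a • dualizingEmbedding R (Submodule.Quotient.mk b) = 0) →
      ∀ a ∈ m, a * b ∈ Ring.jacobson R := by
    intro b hb a ha
    have h1 := hb a ha
    rw [← map_smul, map_eq_zero_iff _ hE.injective] at h1
    exact (Submodule.Quotient.mk_eq_zero _).mp h1
  obtain ⟨s', rfl⟩ := hrange s hs
  obtain ⟨t', rfl⟩ := hrange t ht
  obtain ⟨b, rfl⟩ := Submodule.Quotient.mk_surjective _ s'
  obtain ⟨a, rfl⟩ := Submodule.Quotient.mk_surjective _ t'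
  have ham : a ∉ m := by
    intro ha
    apply ht0
    rw [(Submodule.Quotient.mk_eq_zero _).mpr (Ring.mem_jacobson_of_sq_mem (hker a ht a ha)),
      map_zero]
  obtain ⟨c, i, hi, hc⟩ := hm.exists_inv ham
  refine ⟨c * b, ?_⟩
  rw [← map_smul]
  congr 1
  refine (Submodule.Quotient.eq _).mpr ?_
  have : b - (c * b) • a = i * b := by
    rw [smul_eq_mul]
    linear_combination -b * hc
  rw [this]
  exact hker b hs i hi

variable {Λ : Type u} [Ring Λ] [Algebra R Λ] {X : Type u} [AddCommGroup X] [Module R X]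
  [Module Λᵐᵒᵖ X] [IsScalarTower R Λᵐᵒᵖ X]

theorem DualModule.smul_apply (a : Λ) (φ : DualModule R X) (x : X) :
    (a • φ : DualModule R X).toFun x = φ.toFun (MulOpposite.op a • x) := rfl

/-- Scalars from `R` act by `Λᵐᵒᵖ`-linear maps, so by Schur's lemma each acts bijectively or as
zero. The annihilator is thus prime, and primes of an artinian ring are maximal. -/
theorem isMaximal_annihilator_of_isSimpleModule [IsArtinianRing R] [IsSimpleModule Λᵐᵒᵖ X] :
    (Module.annihilator R X).IsMaximal := by
  have : SMulCommClass Λᵐᵒᵖ R X := (IsScalarTower.to_smulCommClass (R := R)).symm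
  have := IsSimpleModule.nontrivial Λᵐᵒᵖ X
  have hprime : (Module.annihilator R X).IsPrime := by
    refine ⟨fun h => ?_, fun {a b} hab => ?_⟩
    · obtain ⟨x, hx⟩ := exists_ne (0 : X)
      have h1 := Module.mem_annihilator.mp (h ▸ Submodule.mem_top : (1 : R) ∈ _) x
      exact hx (by rwa [one_smul] at h1)
    · let f : X →ₗ[Λᵐᵒᵖ] X := DistribSMul.toLinearMap Λᵐᵒᵖ X a
      rcases LinearMap.bijective_or_eq_zero f with hf | hf
      · right
        refine Module.mem_annihilator.mpr fun x => hf.1 ?_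
        rw [map_zero]
        change a • b • x = 0
        rw [← mul_smul]
        exact Module.mem_annihilator.mp hab x
      · left
        exact Module.mem_annihilator.mpr fun x => LinearMap.congr_fun hf x
  exact IsArtinianRing.isMaximal_of_isPrime _

/-- The common kernel of a non-zero `W` is a proper submodule of `X`, so zero, and finitely many
members of `W` already have zero common kernel. They embed `X` in a power of `E`, and injectivity
writes any `ψ` as a sum of maps `h ∘ φ` with `φ ∈ W`. Each is an `R`-multiple of `φ`, since the
values of `φ` lie in a one-dimensional torsion part of `E`. -/
theorem isSimpleModule_dualModule [IsArtinianRing R] [Module.Finite R X]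
    [IsSimpleModule Λᵐᵒᵖ X] : IsSimpleModule Λ (DualModule R X) := by
  classical
  have hE := isInjectiveEnvelope_dualizingEmbedding R
  have hm := isMaximal_annihilator_of_isSimpleModule (R := R) (Λ := Λ) (X := X)
  have := IsSimpleModule.nontrivial Λᵐᵒᵖ X
  have hkill : ∀ (φ : X →ₗ[R] dualizingModule R) (x : X), ∀ a ∈ Module.annihilator R X,
      a • φ x = 0 := fun φ x a ha => by
    rw [← map_smul, Module.mem_annihilator.mp ha x, map_zero]
  have hnt : Nontrivial (DualModule R X) := by
    obtain ⟨x, hx⟩ := exists_ne (0 : X)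
    obtain ⟨φ, hφ⟩ := exists_dualizingModule_apply_ne_zero (R := R) hx
    exact ⟨φ, (0 : X →ₗ[R] dualizingModule R), fun h => hφ (by rw [h]; rfl)⟩
  have hor : ∀ W : Submodule Λ (DualModule R X), W = ⊥ ∨ W = ⊤ := ?_
  · exact { exists_pair_ne := ⟨⊥, ⊤, bot_ne_top⟩, eq_bot_or_eq_top := hor }
  intro W
  refine or_iff_not_imp_left.mpr fun hW => ?_
  have hWR : ∀ φ : X →ₗ[R] dualizingModule R, φ ∈ W →
      ∀ c : R, (c • φ : X →ₗ[R] dualizingModule R) ∈ W := by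
    intro φ hφ c
    have h1 := W.smul_mem (algebraMap R Λ c) hφ
    have h2 : c • φ = φ ∘ₗ DistribSMul.toLinearMap R X (MulOpposite.op (algebraMap R Λ c)) := by
      refine LinearMap.ext fun x => ?_
      change c • φ x = φ (algebraMap R Λᵐᵒᵖ c • x)
      rw [algebraMap_smul, map_smul]
    rw [h2]
    exact h1
  let L : Submodule Λᵐᵒᵖ X :=
    { carrier := {x | ∀ φ : X →ₗ[R] dualizingModule R, φ ∈ W → φ x = 0}
      add_mem' := fun {x y} hx hy φ hφ => by rw [map_add, hx φ hφ, hy φ hφ, add_zero]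
      zero_mem' := fun φ _ => map_zero φ
      smul_mem' := fun c x hx φ hφ => hx _ (W.smul_mem c.unop hφ) }
  have hL : L = ⊥ := by
    refine (eq_bot_or_eq_top L).resolve_right fun h => hW ?_
    rw [eq_bot_iff]
    intro φ hφ
    refine LinearMap.ext (fun x => ?_ : ∀ x, φ.toFun x = 0)
    have h1 : x ∈ L := h ▸ Submodule.mem_top
    exact h1 φ hφ
  obtain ⟨K, ⟨F, hF, rfl⟩, hmin⟩ := WellFounded.has_min
    (wellFounded_lt : WellFounded (fun A B : Submodule R X => A < B))
    {K | ∃ F : Finset (X →ₗ[R] dualizingModule R), (∀ φ ∈ F, φ ∈ W) ∧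
      K = ⨅ φ ∈ F, LinearMap.ker φ} ⟨_, ∅, by simp, rfl⟩
  have hinj : ∀ x, (∀ φ ∈ F, φ x = 0) → x = 0 := by
    intro x hx
    have h1 : x ∈ L := by
      intro φ hφ
      by_contra hne
      refine hmin _ ⟨insert φ F, ?_, rfl⟩ (lt_of_le_of_ne ?_ ?_)
      · intro ψ hψ
        rcases Finset.mem_insert.mp hψ with rfl | hψ
        · exact hφ
        · exact hF ψ hψ
      · exact biInf_mono fun ψ hψ => Finset.mem_insert_of_mem hψ
      · intro heq
        have h2 : x ∈ ⨅ φ ∈ F, LinearMap.ker φ := by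
          simp only [Submodule.mem_iInf, LinearMap.mem_ker]
          exact hx
        rw [← heq] at h2
        simp only [Submodule.mem_iInf, LinearMap.mem_ker] at h2
        exact hne (h2 φ (Finset.mem_insert_self _ _))
    rw [hL] at h1
    exact h1
  let Φ : X →ₗ[R] (F → dualizingModule R) := LinearMap.pi fun φ => φ.1
  have hΦ : Function.Injective Φ := by
    rw [← LinearMap.ker_eq_bot, eq_bot_iff]
    intro x hx
    exact hinj x fun φ hφ => congrFun hx ⟨φ, hφ⟩
  rw [eq_top_iff]
  intro ψ' _
  let ψ : X →ₗ[R] dualizingModule R := ψ'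
  obtain ⟨Ψ, hΨ⟩ := hE.injective_module.out Φ hΦ ψ
  have hsum : ψ = ∑ φ : F, (Ψ ∘ₗ LinearMap.single R (fun _ : F => dualizingModule R) φ) ∘ₗ φ.1 := by
    refine LinearMap.ext fun x => ?_
    rw [← hΨ, ← Finset.univ_sum_single (Φ x), map_sum, LinearMap.sum_apply]
    rfl
  change ψ ∈ W
  rw [hsum]
  refine Submodule.sum_mem W fun φ _ => ?_
  generalize Ψ ∘ₗ LinearMap.single R (fun _ : F => dualizingModule R) φ = h
  obtain ⟨c, hc⟩ : ∃ c : R, h ∘ₗ φ.1 = c • φ.1 := by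
    by_cases h0 : φ.1 = 0
    · exact ⟨0, by rw [h0, LinearMap.comp_zero, smul_zero]⟩
    obtain ⟨x₀, hx₀⟩ : ∃ x, φ.1 x ≠ 0 := by
      by_contra! hall
      exact h0 (LinearMap.ext hall)
    obtain ⟨c, hc⟩ := exists_smul_eq_of_forall_smul_eq_zero hm (hkill (h ∘ₗ φ.1) x₀)
      (hkill φ.1 x₀) hx₀
    refine ⟨c, LinearMap.ext fun x => ?_⟩
    obtain ⟨d, hd⟩ := exists_smul_eq_of_forall_smul_eq_zero hm (hkill φ.1 x) (hkill φ.1 x₀) hx₀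
    rw [LinearMap.comp_apply] at hc ⊢
    rw [LinearMap.smul_apply, hd, map_smul, hc, smul_comm]
  rw [hc]
  exact hWR φ.1 (hF φ.1 φ.2) c

end Duality

/-! ### The Auslander-Reiten translate of a simple module -/

section Translate

variable {R Λ : Type u} [CommRing R] [Ring Λ] [Algebra R Λ] {M N P Q U S T A : Type u}
  [AddCommGroup M] [Module Λ M] [AddCommGroup N] [Module Λ N]
  [AddCommGroup P] [Module Λ P] [AddCommGroup Q] [Module Λ Q]
  [AddCommGroup U] [Module Λ U] [AddCommGroup A] [Module Λ A]
  [AddCommGroup S] [Module Λ S] [AddCommGroup T] [Module Λ T]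

/-- If the images of `h` and `h ∘ d` agreed, then `P = im d + ker h`, and uniseriality would make
`d` surjective or `h` zero. -/
theorem IsPrincipalIndecomposable.not_range_le_of_eq_comp (hP : IsPrincipalIndecomposable Λ P)
    (hl : IsLeftSerial Λ) {d : Q →ₗ[Λ] P} {e : Q →ₗ[Λ] A} {h : P →ₗ[Λ] A}
    (hd : LinearMap.range d ≠ ⊤) (he : e ≠ 0) (heh : e = h ∘ₗ d) :
    ¬ LinearMap.range h ≤ LinearMap.range e := by
  intro hle
  apply hd
  refine (hP.uniserial hl).eq_top_of_sup_eq_top (B := LinearMap.ker h)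
    (eq_top_iff.mpr fun p _ => ?_) ?_
  · obtain ⟨q, hq⟩ := hle ⟨p, rfl⟩
    rw [← add_sub_cancel (d q) p]
    refine Submodule.add_mem_sup ⟨q, rfl⟩ ?_
    rw [LinearMap.mem_ker, map_sub, ← hq, heh, LinearMap.comp_apply, sub_self]
  · intro hker
    rw [heh, LinearMap.ker_eq_top.mp hker, LinearMap.zero_comp] at he
    exact he rfl

/-- If `d : P → Q` is a map of principal indecomposable modules whose image is the radical of
`Q`, then the cokernel of its dual is simple. -/
theorem isCoatom_range_homToRing [IsArtinianRing Λ] (hl : IsLeftSerial Λ)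
    (hr : IsLeftSerial Λᵐᵒᵖ) (hP : IsPrincipalIndecomposable Λ P)
    (hQ : IsPrincipalIndecomposable Λ Q) {d : P →ₗ[Λ] Q}
    (hd : LinearMap.range d = Module.jacobson Λ Q) (hd0 : d ≠ 0) :
    IsCoatom (LinearMap.range (homToRing d)) := by
  have := hP.nontrivial
  have := hQ.nontrivial
  have := hP.finite
  have := hQ.finite
  have := hP.projective
  have := hQ.projective
  have hQu := hQ.uniserial hl
  have hdtop : LinearMap.range d ≠ ⊤ := by
    rw [hd]
    exact hQu.isCoatom_jacobson.1
  constructor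
  · intro htop
    obtain ⟨i, r, hri⟩ := hP.exists_retraction hl
    obtain ⟨g, hg⟩ : i ∈ LinearMap.range (homToRing d) := htop ▸ Submodule.mem_top
    have hs : ∀ p, (r ∘ₗ g) (d p) = p := fun p => by
      rw [LinearMap.comp_apply, show g (d p) = i p from LinearMap.congr_fun hg p]
      exact LinearMap.congr_fun hri p
    have hbij := hQ.indecomposable.bijective_of_surjective (f := r ∘ₗ g) fun p => ⟨d p, hs p⟩
    apply hdtop
    rw [LinearMap.range_eq_top]
    exact fun q => ⟨(r ∘ₗ g) q, hbij.1 (hs _)⟩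
  · intro V hV
    -- Some component `r ∘ a` does not factor through `d`, so `d = h ∘ r ∘ a`, where `h` is not
    -- surjective and thus has image in `rad Q = im d`. This forces `r ∘ a` to be surjective, hence
    -- bijective, and then `a` generates `Hom(P, Λ)`.
    obtain ⟨a, haV, haW⟩ := SetLike.exists_of_lt hV
    obtain ⟨A, r, i, hA, hri⟩ : ∃ (A : ModuleCat.{u} Λ) (r : Λ →ₗ[Λ] A) (i : A →ₗ[Λ] Λ),
        IsPrincipalIndecomposable Λ A ∧ i ∘ₗ r ∘ₗ a ∉ LinearMap.range (homToRing d) := by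
      by_contra! hall
      exact haW (mem_of_principal_retracts (LinearMap.range (homToRing d)).toAddSubgroup a hall)
    have := hA.nontrivial
    have := hA.projective
    have hnot : ∀ h : Q →ₗ[Λ] A, r ∘ₗ a ≠ h ∘ₗ d := by
      intro h hh
      exact hri ⟨i ∘ₗ h, by rw [hh]; rfl⟩
    obtain ⟨h, hh⟩ :=
      (hP.exists_eq_comp_or hA hQ hl hr (r ∘ₗ a) d).resolve_left fun ⟨h, hh⟩ => hnot h hh
    have hsurj : ¬ Function.Surjective h := by
      intro hsurj
      let e := LinearEquiv.ofBijective h (hA.indecomposable.bijective_of_surjective hsurj)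
      refine hnot e.symm.toLinearMap ?_
      rw [hh]
      exact LinearMap.ext fun p => (e.symm_apply_apply _).symm
    have hra : Function.Surjective (r ∘ₗ a) := by
      by_contra hcon
      refine hA.not_range_le_of_eq_comp hl (mt LinearMap.range_eq_top.mp hcon) hd0 hh ?_
      rw [hd]
      exact hQu.le_jacobson (mt LinearMap.range_eq_top.mp hsurj)
    let e := LinearEquiv.ofBijective (r ∘ₗ a) (hP.indecomposable.bijective_of_surjective hra)
    rw [eq_top_iff]
    intro g _
    have hg : g = MulOpposite.op ((g ∘ₗ e.symm.toLinearMap ∘ₗ r) 1) • a := by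
      refine LinearMap.ext fun p => ?_
      change g p = a p • (g ∘ₗ e.symm.toLinearMap ∘ₗ r) 1
      rw [← map_smul, smul_eq_mul, mul_one]
      exact congrArg g (e.symm_apply_apply p).symm
    rw [hg]
    exact V.smul_mem _ haV

/-- If `φ` does not vanish on the class of the generator `i`, then `p ↦ i p • φ` is a non-zero map
to a simple module: `i (r 1) • φ` and `φ` agree on that class. -/
theorem nonempty_top_equiv_dualModule [IsArtinianRing R] [Module.Finite R Λ]
    (hl : IsLeftSerial Λ) (hP : IsPrincipalIndecomposable Λ P)
    (W : Submodule Λᵐᵒᵖ (P →ₗ[Λ] Λ)) (hW : IsCoatom W) :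
    Nonempty (ModuleTop Λ P ≃ₗ[Λ] DualModule R ((P →ₗ[Λ] Λ) ⧸ W)) := by
  have : IsSimpleModule Λᵐᵒᵖ ((P →ₗ[Λ] Λ) ⧸ W) := isSimpleModule_iff_isCoatom.mpr hW
  have := (hP.dual hl).finite
  have : Module.Finite R Λᵐᵒᵖ :=
    Module.Finite.equiv (MulOpposite.opLinearEquiv R : Λ ≃ₗ[R] Λᵐᵒᵖ)
  have : Module.Finite R ((P →ₗ[Λ] Λ) ⧸ W) := Module.Finite.trans Λᵐᵒᵖ _
  have hD : IsSimpleModule Λ (DualModule R ((P →ₗ[Λ] Λ) ⧸ W)) := isSimpleModule_dualModule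
  obtain ⟨i, r, hri⟩ := hP.exists_retraction hl
  have hr : ∀ c : Λ, r c = c • r 1 := fun c => by rw [← map_smul, smul_eq_mul, mul_one]
  have hgen : ∀ g : P →ₗ[Λ] Λ, MulOpposite.op (g (r 1)) • i = g := by
    intro g
    refine LinearMap.ext fun p => ?_
    change i p • g (r 1) = g p
    rw [← map_smul, ← hr]
    exact congrArg g (LinearMap.congr_fun hri p)
  have hiW : W.mkQ i ≠ 0 := by
    intro h
    refine hW.1 (eq_top_iff.mpr fun g _ => ?_)
    rw [← hgen g]
    exact W.smul_mem _ (by simpa using h)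
  obtain ⟨φ, hφ⟩ := exists_dualizingModule_apply_ne_zero (R := R) hiW
  let φ' : DualModule R ((P →ₗ[Λ] Λ) ⧸ W) := φ
  let F : P →ₗ[Λ] DualModule R ((P →ₗ[Λ] Λ) ⧸ W) :=
    LinearMap.toSpanSingleton Λ (DualModule R ((P →ₗ[Λ] Λ) ⧸ W)) φ' ∘ₗ i
  refine (hP.uniserial hl).nonempty_top_equiv (f := F) (LinearMap.surjective_of_ne_zero ?_)
  intro hF
  apply hφ
  have h1 : i (r 1) • φ' = 0 := LinearMap.congr_fun hF (r 1)
  have h2 : (i (r 1) • φ').toFun (W.mkQ i) = 0 := by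
    rw [h1]
    rfl
  rw [DualModule.smul_apply, ← map_smul, hgen i] at h2
  exact h2

theorem IsUniserial.exists_surjective_of_top_equiv [Module.Projective Λ P] (hM : IsUniserial Λ M)
    [Module.Finite Λ M] [Nontrivial M] (e : ModuleTop Λ P ≃ₗ[Λ] ModuleTop Λ M) :
    ∃ f : P →ₗ[Λ] M, Function.Surjective f := by
  obtain ⟨f, hf⟩ := Module.projective_lifting_property (Module.jacobson Λ M).mkQ
    (e.toLinearMap ∘ₗ (Module.jacobson Λ P).mkQ) (Submodule.mkQ_surjective _)
  refine ⟨f, ?_⟩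
  rw [← LinearMap.range_eq_top]
  by_contra hne
  have := hM.isSimpleModule_top
  have := IsSimpleModule.nontrivial Λ (ModuleTop Λ M)
  obtain ⟨t, ht⟩ := exists_ne (0 : ModuleTop Λ M)
  obtain ⟨p, hp⟩ := (e.surjective.comp (Submodule.mkQ_surjective _)) t
  apply ht
  rw [← hp]
  change (e.toLinearMap ∘ₗ (Module.jacobson Λ P).mkQ) p = 0
  rw [← hf]
  simpa using hM.le_jacobson hne ⟨p, rfl⟩

theorem IsSimpleModule.isUniserial [IsSimpleModule Λ S] : IsUniserial Λ S := fun A B =>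
  by
  rcases eq_bot_or_eq_top A with rfl | rfl
  · exact Or.inl bot_le
  · exact Or.inr le_top

theorem nontrivial_syzygy [IsArtinianRing Λ] [Module.Finite Λ M]
    (hM : ¬ Module.Projective Λ M) : Nontrivial (syzygy Λ M) := by
  rw [Submodule.nontrivial_iff_ne_bot]
  intro h
  have hcov := isProjectiveCover_projCoverMap Λ M
  have := hcov.projective
  exact hM (Module.Projective.of_equiv
    (LinearEquiv.ofBijective _ ⟨LinearMap.ker_eq_bot.mp h, hcov.surjective⟩))

theorem isCoatom_syzygy [IsArtinianRing Λ] [IsSimpleModule Λ S] : IsCoatom (syzygy Λ S) :=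
  isCoatom_ker_of_surjective (isProjectiveCover_projCoverMap Λ S).surjective

theorem isPrincipalIndecomposable_projCover_of_isSimpleModule [IsArtinianRing Λ]
    [IsSimpleModule Λ S] : IsPrincipalIndecomposable Λ (ProjCover Λ S) := by
  have := IsSimpleModule.nontrivial Λ S
  exact isPrincipalIndecomposable_projCover IsSimpleModule.isUniserial

/-- `τ S` is the top of the radical of `P(S)`. -/
theorem nonempty_top_syzygy_equiv_translate [IsArtinianRing R] [Module.Finite R Λ]
    [IsArtinianRing Λ] (hl : IsLeftSerial Λ) (hr : IsLeftSerial Λᵐᵒᵖ) [IsSimpleModule Λ S]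
    (hS : ¬ Module.Projective Λ S) :
    Nonempty (ModuleTop Λ (syzygy Λ S) ≃ₗ[Λ] ARTranslate R Λ S) := by
  have hP := isPrincipalIndecomposable_projCover_of_isSimpleModule (Λ := Λ) (S := S)
  have := hP.finite
  have hKn := nontrivial_syzygy hS
  have hK : IsUniserial Λ (syzygy Λ S) :=
    (hP.uniserial hl).of_injective (Submodule.injective_subtype _)
  have hcov := isProjectiveCover_projCoverMap Λ (syzygy Λ S)
  have hQ := isPrincipalIndecomposable_projCover hK
  have := hQ.finite
  have hd : LinearMap.range (presentationMap Λ S) = syzygy Λ S := by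
    rw [presentationMap, LinearMap.range_comp, LinearMap.range_eq_top.mpr hcov.surjective,
      Submodule.map_top, Submodule.range_subtype]
  have hd0 : presentationMap Λ S ≠ 0 := by
    intro h
    rw [h, LinearMap.range_zero] at hd
    exact (Submodule.nontrivial_iff_ne_bot.mp hKn) hd.symm
  -- The minimal presentation has image `rad P(S)`, so `Tr S` is simple and its dual is the top of
  -- `P(ΩS)`, which is also the top of `ΩS`.
  obtain ⟨e⟩ := nonempty_top_equiv_dualModule (R := R) hl hQ _
    (isCoatom_range_homToRing hl hr hQ hP
      (hd.trans ((hP.uniserial hl).jacobson_eq isCoatom_syzygy).symm) hd0)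
  obtain ⟨e'⟩ := (hQ.uniserial hl).nonempty_top_equiv_top hcov.surjective
  exact ⟨e'.symm.trans e⟩

/-- The cover `P(S)` maps onto the uniserial module `U`, and `ΩS` maps onto `ker f`; so both have
the same top. -/
theorem nonempty_top_ker_equiv_translate [IsArtinianRing R] [Module.Finite R Λ]
    [IsArtinianRing Λ] (hl : IsLeftSerial Λ) (hr : IsLeftSerial Λᵐᵒᵖ)
    (hns : NoSimpleProjective Λ) [IsSimpleModule Λ S] (hU : IsUniserial Λ U)
    [Module.Finite Λ U] {f : U →ₗ[Λ] S} (hf : Function.Surjective f)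
    (hker : LinearMap.ker f ≠ ⊥) :
    Nonempty (ModuleTop Λ (LinearMap.ker f) ≃ₗ[Λ] ARTranslate R Λ S) := by
  have hS := hns S inferInstance
  obtain ⟨e⟩ := nonempty_top_syzygy_equiv_translate (R := R) hl hr hS
  have hP := isPrincipalIndecomposable_projCover_of_isSimpleModule (Λ := Λ) (S := S)
  have := hP.finite
  have := hP.projective
  obtain ⟨g, hg⟩ := Module.projective_lifting_property f (projCoverMap Λ S) hf
  have hg' : ∀ p, f (g p) = projCoverMap Λ S p := fun p => LinearMap.congr_fun hg p
  have hgs : Function.Surjective g := by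
    rw [← LinearMap.range_eq_top]
    refine hU.eq_top_of_sup_eq_top (B := LinearMap.ker f) (eq_top_iff.mpr fun u _ => ?_)
      (isCoatom_ker_of_surjective hf).1
    obtain ⟨p, hp⟩ := (isProjectiveCover_projCoverMap Λ S).surjective (f u)
    rw [← add_sub_cancel (g p) u]
    refine Submodule.add_mem_sup ⟨p, rfl⟩ ?_
    rw [LinearMap.mem_ker, map_sub, hg', hp, sub_self]
  let k : syzygy Λ S →ₗ[Λ] LinearMap.ker f := g.restrict fun p hp => by
    rw [LinearMap.mem_ker, hg']
    exact hp
  have hk : Function.Surjective k := by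
    rintro ⟨u, hu⟩
    obtain ⟨p, rfl⟩ := hgs u
    exact ⟨⟨p, by rw [LinearMap.mem_ker, hg'] at hu; exact hu⟩, rfl⟩
  have : Nontrivial (LinearMap.ker f) := Submodule.nontrivial_iff_ne_bot.mpr hker
  obtain ⟨e'⟩ := ((hP.uniserial hl).of_injective
    (Submodule.injective_subtype (syzygy Λ S))).nonempty_top_equiv_top hk
  exact ⟨e'.symm.trans e⟩

/-- The top of the kernel of a proper epimorphism `Q → N` of uniserial modules is `τ soc N`. -/
theorem nonempty_top_ker_equiv_translate_socle [IsArtinianRing R] [Module.Finite R Λ]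
    [IsArtinianRing Λ] (hl : IsLeftSerial Λ) (hr : IsLeftSerial Λᵐᵒᵖ)
    (hns : NoSimpleProjective Λ) (hQ : IsUniserial Λ Q) [Module.Finite Λ Q] [Nontrivial N]
    {p : Q →ₗ[Λ] N} (hp : Function.Surjective p) (hker : LinearMap.ker p ≠ ⊥) :
    Nonempty (ModuleTop Λ (LinearMap.ker p) ≃ₗ[Λ] ARTranslate R Λ (socle Λ N)) := by
  have := Module.Finite.of_surjective p hp
  have := (hQ.of_surjective hp).isSimpleModule_socle
  -- Restricting to the preimage of the socle keeps the kernel and makes the target simple.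
  let L := (socle Λ N).comap p
  have hL : IsUniserial Λ L := hQ.of_injective L.injective_subtype
  let f : L →ₗ[Λ] socle Λ N := p.restrict fun x hx => hx
  have hf : Function.Surjective f := by
    rintro ⟨y, hy⟩
    obtain ⟨x, rfl⟩ := hp y
    exact ⟨⟨x, hy⟩, rfl⟩
  let k : LinearMap.ker f →ₗ[Λ] LinearMap.ker p := L.subtype.restrict fun x hx =>
    congrArg Subtype.val hx
  have hk : Function.Surjective k := by
    rintro ⟨x, hx⟩
    have hxL : x ∈ L := by
      change p x ∈ socle Λ N
      rw [hx]
      exact zero_mem _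
    exact ⟨⟨⟨x, hxL⟩, Subtype.ext hx⟩, rfl⟩
  have : Nontrivial (LinearMap.ker p) := Submodule.nontrivial_iff_ne_bot.mpr hker
  have : Nontrivial (LinearMap.ker f) := hk.nontrivial
  obtain ⟨e⟩ := nonempty_top_ker_equiv_translate (R := R) hl hr hns hL hf
    (Submodule.nontrivial_iff_ne_bot.mp this)
  obtain ⟨e'⟩ := (hL.of_injective (Submodule.injective_subtype
    (LinearMap.ker f))).nonempty_top_equiv_top hk
  exact ⟨e'.symm.trans e⟩

/-- Projective covers are mere choices, so invariance needs an argument: `P(S) → S ≅ T` has kernel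
`ΩS`, whose top computes both translates. -/
theorem nonempty_translate_equiv_of_equiv [IsArtinianRing R] [Module.Finite R Λ]
    [IsArtinianRing Λ] (hl : IsLeftSerial Λ) (hr : IsLeftSerial Λᵐᵒᵖ)
    (hns : NoSimpleProjective Λ) [IsSimpleModule Λ S] (e : S ≃ₗ[Λ] T) :
    Nonempty (ARTranslate R Λ S ≃ₗ[Λ] ARTranslate R Λ T) := by
  have : IsSimpleModule Λ T := IsSimpleModule.congr e.symm
  have hP := isPrincipalIndecomposable_projCover_of_isSimpleModule (Λ := Λ) (S := S)
  have := hP.finite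
  have h1 := nontrivial_syzygy (hns S inferInstance)
  obtain ⟨a⟩ := nonempty_top_syzygy_equiv_translate (R := R) hl hr (hns S inferInstance)
  have hk : LinearMap.ker (e.toLinearMap ∘ₗ projCoverMap Λ S) = syzygy Λ S :=
    LinearEquiv.ker_comp _ _
  obtain ⟨b⟩ := nonempty_top_ker_equiv_translate (R := R) hl hr hns (hP.uniserial hl)
    (f := e.toLinearMap ∘ₗ projCoverMap Λ S)
    (e.surjective.comp (isProjectiveCover_projCoverMap Λ S).surjective)
    (by rw [hk]; exact Submodule.nontrivial_iff_ne_bot.mp h1)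
  rw [hk] at b
  exact ⟨a.symm.trans b⟩

/-- The Auslander-Reiten translation is injective on simple modules. -/
theorem nonempty_equiv_of_translate_equiv [IsArtinianRing R] [Module.Finite R Λ]
    [IsArtinianRing Λ] (hl : IsLeftSerial Λ) (hr : IsLeftSerial Λᵐᵒᵖ)
    (hns : NoSimpleProjective Λ) [IsSimpleModule Λ S] [IsSimpleModule Λ T]
    (e : ARTranslate R Λ S ≃ₗ[Λ] ARTranslate R Λ T) : Nonempty (S ≃ₗ[Λ] T) := by
  have hP := isPrincipalIndecomposable_projCover_of_isSimpleModule (Λ := Λ) (S := S)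
  have hQ := isPrincipalIndecomposable_projCover_of_isSimpleModule (Λ := Λ) (S := T)
  have := hP.finite
  have := hQ.finite
  have hPn := nontrivial_syzygy (hns S inferInstance)
  have hQn := nontrivial_syzygy (hns T inferInstance)
  have hPu := hP.uniserial hl
  have hQu := hQ.uniserial hl
  have hKu : IsUniserial Λ (syzygy Λ S) := hPu.of_injective (Submodule.injective_subtype _)
  have hLu : IsUniserial Λ (syzygy Λ T) := hQu.of_injective (Submodule.injective_subtype _)
  obtain ⟨a⟩ := nonempty_top_syzygy_equiv_translate (R := R) hl hr (hns S inferInstance)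
  obtain ⟨b⟩ := nonempty_top_syzygy_equiv_translate (R := R) hl hr (hns T inferInstance)
  have hV := isPrincipalIndecomposable_projCover hKu
  have hcov := isProjectiveCover_projCoverMap Λ (syzygy Λ S)
  have := hV.projective
  have := hV.finite
  obtain ⟨c⟩ := (hV.uniserial hl).nonempty_top_equiv_top hcov.surjective
  -- The radicals of `P(S)` and `P(T)` have isomorphic tops, so `P(ΩS)` maps onto both. One of the
  -- maps `d`, `d'` factors through the other by some `h`. If `h` were not surjective, its image
  -- would lie in the radical, which is the image of the composite; `not_range_le_of_eq_comp`
  -- excludes this. So the tops agree.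
  obtain ⟨f, hf⟩ := hLu.exists_surjective_of_top_equiv (P := ProjCover Λ (syzygy Λ S))
    (((c.trans a).trans e).trans b.symm)
  let d : ProjCover Λ (syzygy Λ S) →ₗ[Λ] ProjCover Λ S := presentationMap Λ S
  let d' : ProjCover Λ (syzygy Λ S) →ₗ[Λ] ProjCover Λ T := (syzygy Λ T).subtype ∘ₗ f
  have hd : LinearMap.range d = syzygy Λ S := by
    change LinearMap.range (presentationMap Λ S) = _
    rw [presentationMap, LinearMap.range_comp, LinearMap.range_eq_top.mpr hcov.surjective,
      Submodule.map_top, Submodule.range_subtype]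
  have hd' : LinearMap.range d' = syzygy Λ T := by
    rw [LinearMap.range_comp, LinearMap.range_eq_top.mpr hf, Submodule.map_top,
      Submodule.range_subtype]
  have hne : ∀ {X : Type u} [AddCommGroup X] [Module Λ X]
      {g : ProjCover Λ (syzygy Λ S) →ₗ[Λ] ProjCover Λ X}, Nontrivial (syzygy Λ X) →
      LinearMap.range g = syzygy Λ X → g ≠ 0 := by
    intro X _ _ g hX hg h
    rw [h, LinearMap.range_zero] at hg
    exact (Submodule.nontrivial_iff_ne_bot.mp hX) hg.symm
  obtain ⟨tS⟩ := hPu.nonempty_top_equiv (isProjectiveCover_projCoverMap Λ S).surjective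
  obtain ⟨tT⟩ := hQu.nonempty_top_equiv (isProjectiveCover_projCoverMap Λ T).surjective
  have := hP.nontrivial
  have := hQ.nontrivial
  rcases hV.exists_eq_comp_or hP hQ hl hr d d' with ⟨h, hh⟩ | ⟨h, hh⟩
  · have hs : Function.Surjective h := by
      rw [← LinearMap.range_eq_top]
      by_contra hcon
      refine hQ.not_range_le_of_eq_comp hl ?_ (hne hPn hd) hh ?_
      · rw [hd']; exact isCoatom_syzygy.1
      · rw [hd, ← hPu.jacobson_eq isCoatom_syzygy]
        exact hPu.le_jacobson hcon
    obtain ⟨t⟩ := hQu.nonempty_top_equiv_top hs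
    exact ⟨(tS.symm.trans t.symm).trans tT⟩
  · have hs : Function.Surjective h := by
      rw [← LinearMap.range_eq_top]
      by_contra hcon
      refine hP.not_range_le_of_eq_comp hl ?_ (hne hQn hd') hh ?_
      · rw [hd]; exact isCoatom_syzygy.1
      · rw [hd', ← hQu.jacobson_eq isCoatom_syzygy]
        exact hQu.le_jacobson hcon
    obtain ⟨t⟩ := hPu.nonempty_top_equiv_top hs
    exact ⟨(tS.symm.trans t).trans tT⟩

end Translate

/-- `X` is the first syzygy module of `N`, formed with a principal indecomposable module. -/
def IsSyzygy (Λ : Type u) [Ring Λ] (X N : Type u) [AddCommGroup X] [Module Λ X]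
    [AddCommGroup N] [Module Λ N] : Prop :=
  ∃ (Q : ModuleCat.{u} Λ) (f : X →ₗ[Λ] Q) (g : Q →ₗ[Λ] N), IsPrincipalIndecomposable Λ Q ∧
    Function.Injective f ∧ Function.Exact f g ∧ Function.Surjective g

/-- A finitely generated non-zero uniserial module which is not projective. -/
structure IsNonprojectiveUniserial (Λ : Type u) [Ring Λ] (X : Type u) [AddCommGroup X]
    [Module Λ X] : Prop where
  finite : Module.Finite Λ X
  uniserial : IsUniserial Λ X
  nontrivial : Nontrivial X
  not_projective : ¬ Module.Projective Λ X

/-! ### Blackness, the extension property, and arrows from second syzygies -/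

section Black

variable {R Λ : Type u} [CommRing R] [Ring Λ] [Algebra R Λ] {M N P Q S S' T T' X Y A : Type u}
  [AddCommGroup M] [Module Λ M] [AddCommGroup N] [Module Λ N]
  [AddCommGroup P] [Module Λ P] [AddCommGroup Q] [Module Λ Q]
  [AddCommGroup X] [Module Λ X] [AddCommGroup Y] [Module Λ Y] [AddCommGroup A] [Module Λ A]
  [AddCommGroup S] [Module Λ S] [AddCommGroup T] [Module Λ T]
  [AddCommGroup S'] [Module Λ S'] [AddCommGroup T'] [Module Λ T']

open CategoryTheory in
-- Dimension shifting along `ker f → P → S`; the cover need not be minimal.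
theorem isBlack_iff_not_projective_ker [Module.Projective Λ P] {f : P →ₗ[Λ] S}
    (hf : Function.Surjective f) : IsBlack Λ S ↔ ¬ Module.Projective Λ (LinearMap.ker f) := by
  have hP : Projective (ModuleCat.of Λ P) := (IsProjective.iff_projective P).mp inferInstance
  have h := (LinearMap.shortExact_shortComplexKer hf).hasProjectiveDimensionLT_X₃_iff 0 hP
  rw [zero_add, zero_add, ← projective_iff_hasProjectiveDimensionLT_one] at h
  have h2 := projectiveDimension_ge_iff (ModuleCat.of Λ S) 2
  rw [IsBlack]
  refine h2.trans (not_congr (h.trans ?_))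
  exact (IsProjective.iff_projective (R := Λ) (LinearMap.ker f)).symm

/-- The non-zero projective submodule lifts to the uniserial module `P(M)` and avoids the kernel of
the cover, which is therefore an isomorphism. -/
theorem IsUniserial.projective_of_injective [IsArtinianRing Λ] (hl : IsLeftSerial Λ)
    (hM : IsUniserial Λ M) [Module.Finite Λ M] [Module.Projective Λ Q] [Nontrivial Q]
    {j : Q →ₗ[Λ] M} (hj : Function.Injective j) : Module.Projective Λ M := by
  have := hj.nontrivial
  have hcov := isProjectiveCover_projCoverMap Λ M
  have := hcov.projective
  exact Module.Projective.of_equiv (LinearEquiv.ofBijective _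
    (((isPrincipalIndecomposable_projCover hM).uniserial hl).bijective_of_injective_of_projective
      hcov.surjective hj))

/-- By the factorization property either `g` factors through `f`, as wanted, or `f = h ∘ g`. In the
second case `h` can be inverted if it is surjective; otherwise `h` is injective, as `f` is, and
embeds the projective `A` in the uniserial `rad Q`, making `rad Q` projective. -/
theorem IsPrincipalIndecomposable.exists_extension_principal [IsArtinianRing Λ]
    (hl : IsLeftSerial Λ) (hr : IsLeftSerial Λᵐᵒᵖ) (hQ : IsPrincipalIndecomposable Λ Q)
    (hrad : ¬ Module.Projective Λ (Module.jacobson Λ Q)) [Nontrivial X] {f : X →ₗ[Λ] Q}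
    (hf : Function.Injective f) (hA : IsPrincipalIndecomposable Λ A) (g : X →ₗ[Λ] A) :
    ∃ v : Q →ₗ[Λ] A, v ∘ₗ f = g := by
  have := hQ.finite
  have := hQ.projective
  have := hQ.nontrivial
  have := hA.projective
  have := hA.nontrivial
  have hQu := hQ.uniserial hl
  have hX := hQu.of_injective hf
  have : IsNoetherian Λ X := isNoetherian_of_injective f hf
  have hcov := isProjectiveCover_projCoverMap Λ X
  have hcancel : ∀ {Z : Type u} [AddCommGroup Z] [Module Λ Z] {u v : X →ₗ[Λ] Z},
      u ∘ₗ projCoverMap Λ X = v ∘ₗ projCoverMap Λ X → u = v := by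
    intro Z _ _ u v h
    exact (LinearMap.cancel_right hcov.surjective).mp h
  rcases (isPrincipalIndecomposable_projCover hX).exists_eq_comp_or hA hQ hl hr
    (g ∘ₗ projCoverMap Λ X) (f ∘ₗ projCoverMap Λ X) with ⟨h, hh⟩ | ⟨h, hh⟩
  · exact ⟨h, (hcancel hh).symm⟩
  have hfg : f = h ∘ₗ g := hcancel hh
  by_cases hs : Function.Surjective h
  · let e := LinearEquiv.ofBijective h (hA.indecomposable.bijective_of_surjective hs)
    refine ⟨e.symm.toLinearMap, LinearMap.ext fun x => ?_⟩
    rw [hfg]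
    exact e.symm_apply_apply (g x)
  · exfalso
    have hle := hQu.le_jacobson (mt LinearMap.range_eq_top.mp hs)
    have hh0 : LinearMap.ker h = ⊥ := by
      refine (hA.uniserial hl).eq_bot_of_inf_eq_bot (B := LinearMap.range g) ?_ ?_
      · rw [eq_bot_iff]
        rintro _ ⟨hx, x, rfl⟩
        have h1 : f x = 0 := by rw [hfg]; exact hx
        rw [(map_eq_zero_iff f hf).mp h1, map_zero]
        exact zero_mem _
      · intro h1
        obtain ⟨x, hx⟩ := exists_ne (0 : X)
        apply hx
        apply hf
        rw [hfg, LinearMap.range_eq_bot.mp h1]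
        simp
    apply hrad
    have hJ : IsUniserial Λ (Module.jacobson Λ Q) :=
      hQu.of_injective (Submodule.injective_subtype _)
    exact hJ.projective_of_injective hl
      (j := h.codRestrict (Module.jacobson Λ Q) fun a => hle ⟨a, rfl⟩)
      fun a b hab => LinearMap.ker_eq_bot.mp hh0 (congrArg Subtype.val hab)

/-- If the radical of `Q` is not projective, then maps from submodules of `Q` to projective
modules extend to `Q`. -/
theorem IsPrincipalIndecomposable.exists_extension [IsArtinianRing Λ]
    (hl : IsLeftSerial Λ) (hr : IsLeftSerial Λᵐᵒᵖ) (hQ : IsPrincipalIndecomposable Λ Q)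
    (hrad : ¬ Module.Projective Λ (Module.jacobson Λ Q)) [Nontrivial X] {f : X →ₗ[Λ] Q}
    (hf : Function.Injective f) (u : X →ₗ[Λ] Λ) : ∃ v : Q →ₗ[Λ] Λ, v ∘ₗ f = u := by
  let W : AddSubgroup (X →ₗ[Λ] Λ) :=
    { carrier := {u | ∃ v : Q →ₗ[Λ] Λ, v ∘ₗ f = u}
      add_mem' := by
        rintro _ _ ⟨v, rfl⟩ ⟨w, rfl⟩
        exact ⟨v + w, LinearMap.add_comp _ _ _⟩
      zero_mem' := ⟨0, LinearMap.zero_comp _⟩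
      neg_mem' := by
        rintro _ ⟨v, rfl⟩
        exact ⟨-v, LinearMap.neg_comp _ _⟩ }
  refine mem_of_principal_retracts W u fun A r i hA => ?_
  obtain ⟨v, hv⟩ := hQ.exists_extension_principal hl hr hrad hf hA (r ∘ₗ u)
  exact ⟨i ∘ₗ v, by rw [LinearMap.comp_assoc, hv]⟩

theorem nonempty_projCover_equiv [IsArtinianRing Λ] (hl : IsLeftSerial Λ) [IsSimpleModule Λ S]
    (hP : IsPrincipalIndecomposable Λ P) (e : ModuleTop Λ P ≃ₗ[Λ] S) :
    Nonempty (P ≃ₗ[Λ] ProjCover Λ S) := by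
  have hQ := isPrincipalIndecomposable_projCover_of_isSimpleModule (Λ := Λ) (S := S)
  have := hQ.finite
  have := hQ.nontrivial
  have := hQ.projective
  have := hP.projective
  obtain ⟨e'⟩ := (hQ.uniserial hl).nonempty_top_equiv
    (isProjectiveCover_projCoverMap Λ S).surjective
  obtain ⟨f, hf⟩ := (hQ.uniserial hl).exists_surjective_of_top_equiv (P := P) (e.trans e'.symm)
  exact ⟨LinearEquiv.ofBijective f (hP.indecomposable.bijective_of_surjective hf)⟩

theorem nonempty_translate_socle_equiv [IsArtinianRing R] [Module.Finite R Λ]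
    [IsArtinianRing Λ] (hl : IsLeftSerial Λ) (hr : IsLeftSerial Λᵐᵒᵖ)
    (hns : NoSimpleProjective Λ) (hN : IsUniserial Λ N) [Module.Finite Λ N] [Nontrivial M]
    {f : M →ₗ[Λ] N} (hf : Function.Injective f) :
    Nonempty (ARTranslate R Λ (socle Λ N) ≃ₗ[Λ] ARTranslate R Λ (socle Λ M)) := by
  have := hf.nontrivial
  have := hN.isSimpleModule_socle
  obtain ⟨e⟩ := hN.nonempty_socle_equiv_socle hf
  exact nonempty_translate_equiv_of_equiv hl hr hns e

/-- If the top of `P` is `S`, then `γ S = τ soc P`. -/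
theorem nonempty_translate_socle_equiv_resolutionMap [IsArtinianRing R] [Module.Finite R Λ]
    [IsArtinianRing Λ] (hl : IsLeftSerial Λ) (hr : IsLeftSerial Λᵐᵒᵖ)
    (hns : NoSimpleProjective Λ) [IsSimpleModule Λ S] (hP : IsPrincipalIndecomposable Λ P)
    (e : ModuleTop Λ P ≃ₗ[Λ] S) :
    Nonempty (ARTranslate R Λ (socle Λ P) ≃ₗ[Λ] ResolutionMap R Λ S) := by
  have hQ := isPrincipalIndecomposable_projCover_of_isSimpleModule (Λ := Λ) (S := S)
  have := hQ.nontrivial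
  have := hP.finite
  obtain ⟨e'⟩ := nonempty_projCover_equiv hl hP e
  exact nonempty_translate_socle_equiv hl hr hns (hP.uniserial hl) (f := e'.symm.toLinearMap)
    e'.symm.injective

theorem ResolutionArrow.congr [IsArtinianRing R] [Module.Finite R Λ]
    [IsArtinianRing Λ] (hl : IsLeftSerial Λ) (hr : IsLeftSerial Λᵐᵒᵖ)
    (hns : NoSimpleProjective Λ) [IsSimpleModule Λ S] (h : ResolutionArrow R Λ S T)
    (e : S ≃ₗ[Λ] S') (e' : T ≃ₗ[Λ] T') : ResolutionArrow R Λ S' T' := by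
  have : IsSimpleModule Λ S' := IsSimpleModule.congr e.symm
  have hP := isPrincipalIndecomposable_projCover_of_isSimpleModule (Λ := Λ) (S := S)
  obtain ⟨a⟩ := h
  obtain ⟨b⟩ := (hP.uniserial hl).nonempty_top_equiv
    (isProjectiveCover_projCoverMap Λ S).surjective
  obtain ⟨c⟩ := nonempty_translate_socle_equiv_resolutionMap (R := R) hl hr hns hP (b.trans e)
  exact ⟨(e'.symm.trans a).trans c⟩

theorem IsSyzygy.nonempty_top_equiv_translate_socle [IsArtinianRing R] [Module.Finite R Λ]
    [IsArtinianRing Λ] (hl : IsLeftSerial Λ) (hr : IsLeftSerial Λᵐᵒᵖ)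
    (hns : NoSimpleProjective Λ) [Nontrivial X] [Nontrivial N] (h : IsSyzygy Λ X N) :
    Nonempty (ModuleTop Λ X ≃ₗ[Λ] ARTranslate R Λ (socle Λ N)) := by
  obtain ⟨Q, f, g, hQ, hf, hfg, hg⟩ := h
  have := hQ.finite
  have hQu := hQ.uniserial hl
  have hr' : LinearMap.range f = LinearMap.ker g := hfg.linearMap_ker_eq.symm
  have : Nontrivial (LinearMap.ker g) := by
    rw [← hr']
    exact (LinearEquiv.ofInjective f hf).symm.toEquiv.nontrivial
  obtain ⟨a⟩ := nonempty_top_ker_equiv_translate_socle (R := R) hl hr hns hQu hg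
    (Submodule.nontrivial_iff_ne_bot.mp this)
  have : IsNoetherian Λ X := isNoetherian_of_injective f hf
  let e : X ≃ₗ[Λ] LinearMap.ker g :=
    (LinearEquiv.ofInjective f hf).trans (LinearEquiv.ofEq _ _ hr')
  obtain ⟨b⟩ := (hQu.of_injective hf).nonempty_top_equiv_top (f := e.toLinearMap) e.surjective
  exact ⟨b.trans a⟩

/-- The top of the second syzygy module of `N` is `γ top N`. -/
theorem IsSyzygy.resolutionArrow [IsArtinianRing R] [Module.Finite R Λ]
    [IsArtinianRing Λ] (hl : IsLeftSerial Λ) (hr : IsLeftSerial Λᵐᵒᵖ)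
    (hns : NoSimpleProjective Λ) [Nontrivial Y] [Nontrivial X] [Nontrivial N]
    (hYX : IsSyzygy Λ Y X) (hXN : IsSyzygy Λ X N) :
    ResolutionArrow R Λ (ModuleTop Λ N) (ModuleTop Λ Y) := by
  obtain ⟨a⟩ := hYX.nonempty_top_equiv_translate_socle (R := R) hl hr hns
  obtain ⟨Q, f, g, hQ, hf, hfg, hg⟩ := hXN
  have := hQ.finite
  have := Module.Finite.of_surjective g hg
  have := ((hQ.uniserial hl).of_surjective hg).isSimpleModule_top
  -- The submodule `X` of `Q` shares its socle, and the quotient `N` shares its top.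
  obtain ⟨b⟩ := nonempty_translate_socle_equiv (R := R) hl hr hns (hQ.uniserial hl) hf
  obtain ⟨c⟩ := (hQ.uniserial hl).nonempty_top_equiv_top hg
  obtain ⟨d⟩ := nonempty_translate_socle_equiv_resolutionMap (R := R) hl hr hns hQ c
  exact ⟨(a.trans b.symm).trans d⟩

end Black

/-- `X` is a direct summand of one of the images in a complete projective resolution. -/
def IsGorensteinRetract (Λ : Type u) [Ring Λ] (X : Type u) [AddCommGroup X] [Module Λ X] : Prop :=
  ∃ (P : ℤ → ModuleCat.{u} Λ) (d : ∀ i : ℤ, P (i + 1) →ₗ[Λ] P i),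
    IsCompleteProjectiveResolution Λ P d ∧
    ∃ (j : ℤ) (s : X →ₗ[Λ] LinearMap.range (d j)) (r : LinearMap.range (d j) →ₗ[Λ] X),
      r ∘ₗ s = LinearMap.id

/-! ### Syzygies and tops of Gorenstein projective modules -/

section Gorenstein

variable {Λ : Type u} [Ring Λ] {X Q A B : Type u} [AddCommGroup X] [Module Λ X]
  [AddCommGroup Q] [Module Λ Q] [AddCommGroup A] [Module Λ A] [AddCommGroup B] [Module Λ B]
  {P : ℤ → ModuleCat.{u} Λ} {d : ∀ i : ℤ, P (i + 1) →ₗ[Λ] P i}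

/-- Lifting arguments produce automorphisms rather than identities, so only bijectivity of `r ∘ s`
is required; `r` is corrected by its inverse. -/
theorem IsCompleteProjectiveResolution.isGorensteinRetract
    (h : IsCompleteProjectiveResolution Λ P d) (j : ℤ) (s : X →ₗ[Λ] LinearMap.range (d j))
    (r : LinearMap.range (d j) →ₗ[Λ] X) (hrs : Function.Bijective (r ∘ₗ s)) :
    IsGorensteinRetract Λ X := by
  refine ⟨P, d, h, j, s, (LinearEquiv.ofBijective (r ∘ₗ s) hrs).symm.toLinearMap ∘ₗ r, ?_⟩
  exact LinearMap.ext fun x => (LinearEquiv.ofBijective (r ∘ₗ s) hrs).symm_apply_apply x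

theorem IsGorensteinProjective.isGorensteinRetract (h : IsGorensteinProjective Λ X) :
    IsGorensteinRetract Λ X := by
  obtain ⟨P, d, hd, ⟨e⟩⟩ := h
  exact ⟨P, d, hd, 0, e.toLinearMap, e.symm.toLinearMap,
    LinearMap.ext fun x => e.symm_apply_apply x⟩

/-- Composed with `d j`, the map `u` is killed by `d (j + 1)`; exactness of the dual complex then
provides `v`. -/
theorem IsCompleteProjectiveResolution.exists_extension
    (h : IsCompleteProjectiveResolution Λ P d) (j : ℤ) (u : LinearMap.range (d j) →ₗ[Λ] Λ) :
    ∃ v : P j →ₗ[Λ] Λ, ∀ y, v y.1 = u y := by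
  obtain ⟨v, hv⟩ := (h.exact_dual j (u ∘ₗ (d j).rangeRestrict)).mp (by
    refine LinearMap.ext fun p => ?_
    change u ((d j).rangeRestrict (d (j + 1) p)) = 0
    have : (d j).rangeRestrict (d (j + 1) p) = 0 :=
      Subtype.ext ((h.exact j).apply_apply_eq_zero p)
    rw [this, map_zero])
  refine ⟨v, ?_⟩
  rintro ⟨_, p, rfl⟩
  exact LinearMap.congr_fun hv p

theorem exists_extension_of_retraction {i : X →ₗ[Λ] Q}
    (h : ∀ u : X →ₗ[Λ] Λ, ∃ v : Q →ₗ[Λ] Λ, ∀ x, v (i x) = u x) {a : A →ₗ[Λ] Λ} {b : Λ →ₗ[Λ] A}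
    (hab : b ∘ₗ a = LinearMap.id) (g : X →ₗ[Λ] A) : ∃ v : Q →ₗ[Λ] A, ∀ x, v (i x) = g x := by
  obtain ⟨v, hv⟩ := h (a ∘ₗ g)
  refine ⟨b ∘ₗ v, fun x => ?_⟩
  rw [LinearMap.comp_apply, hv]
  exact LinearMap.congr_fun hab (g x)

/-- Maps from a syzygy module of a Gorenstein projective module to `Λ` extend. -/
theorem IsGorensteinRetract.exists_extension (hX : IsGorensteinRetract Λ X)
    [Module.Projective Λ Q] {p : Q →ₗ[Λ] X} (hp : Function.Surjective p)
    (u : LinearMap.ker p →ₗ[Λ] Λ) : ∃ v : Q →ₗ[Λ] Λ, ∀ k, v k.1 = u k := by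
  obtain ⟨P, d, hd, j, s, r, hrs⟩ := hX
  have := hd.projective (j + 1)
  obtain ⟨α, hα⟩ := Module.projective_lifting_property (d j).rangeRestrict (s ∘ₗ p)
    (d j).surjective_rangeRestrict
  obtain ⟨β, hβ⟩ := Module.projective_lifting_property p (r ∘ₗ (d j).rangeRestrict) hp
  have hα' : ∀ q, (d j).rangeRestrict (α q) = s (p q) := fun q => LinearMap.congr_fun hα q
  have hβ' : ∀ y, p (β y) = r ((d j).rangeRestrict y) := fun y => LinearMap.congr_fun hβ y
  have hrs' : ∀ x, r (s x) = x := fun x => LinearMap.congr_fun hrs x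
  have hker : ∀ y ∈ LinearMap.range (d (j + 1)), β y ∈ LinearMap.ker p := by
    rintro _ ⟨z, rfl⟩
    have : (d j).rangeRestrict (d (j + 1) z) = 0 :=
      Subtype.ext ((hd.exact j).apply_apply_eq_zero z)
    rw [LinearMap.mem_ker, hβ', this, map_zero]
  obtain ⟨w, hw⟩ := hd.exists_extension (j + 1) (u ∘ₗ β.restrict hker)
  let δ : Q →ₗ[Λ] LinearMap.ker p := (LinearMap.id - β ∘ₗ α).codRestrict _ fun q => by
    rw [LinearMap.mem_ker, LinearMap.sub_apply, map_sub, LinearMap.comp_apply, hβ', hα', hrs']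
    exact sub_self _
  -- `δ = 1 - β ∘ α` has values in `ker p` because `r ∘ s = id`. On `ker p` the map `w ∘ α` equals
  -- `u ∘ β ∘ α`, so the two terms add up to `u`.
  refine ⟨w ∘ₗ α + u ∘ₗ δ, fun k => ?_⟩
  have hαk : α k.1 ∈ LinearMap.range (d (j + 1)) := by
    refine ((hd.exact j) (α k.1)).mp ?_
    have h1 := congrArg Subtype.val (hα' k.1)
    rw [k.2, map_zero] at h1
    exact h1
  have h1 := hw ⟨α k.1, hαk⟩
  change w (α k.1) + u (δ k.1) = u k
  rw [h1, LinearMap.comp_apply, ← map_add]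
  congr 1
  apply Subtype.ext
  change β (α k.1) + (k.1 - β (α k.1)) = k.1
  abel

/-- If `ΩX` were projective, its identity would extend to a surjection `P(X) → ΩX`, necessarily
bijective; then `ΩX = P(X)` and `X = 0`. -/
theorem IsNonprojectiveUniserial.syzygy [IsArtinianRing Λ] (hl : IsLeftSerial Λ)
    (hX : IsNonprojectiveUniserial Λ X) (hG : IsGorensteinRetract Λ X) :
    IsNonprojectiveUniserial Λ (syzygy Λ X) := by
  have := hX.finite
  have := hX.nontrivial
  have hcov := isProjectiveCover_projCoverMap Λ X
  have hQ := isPrincipalIndecomposable_projCover hX.uniserial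
  have := hQ.finite
  have := hQ.projective
  have hn := nontrivial_syzygy hX.not_projective
  have hK : IsUniserial Λ (_root_.syzygy Λ X) :=
    (hQ.uniserial hl).of_injective (Submodule.injective_subtype _)
  refine ⟨inferInstance, hK, hn, fun hproj => ?_⟩
  have hKP : IsPrincipalIndecomposable Λ (_root_.syzygy Λ X) :=
    ⟨inferInstance, hproj, hK.isIndecomposable⟩
  obtain ⟨a, b, hab⟩ := hKP.exists_retraction hl
  obtain ⟨v, hv⟩ := exists_extension_of_retraction (i := (_root_.syzygy Λ X).subtype)
    (fun u => hG.exists_extension hcov.surjective u) hab LinearMap.id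
  have hbij := hQ.indecomposable.bijective_of_surjective (f := v) fun k => ⟨k.1, hv k⟩
  have htop : _root_.syzygy Λ X = ⊤ := by
    rw [eq_top_iff]
    intro q _
    have : q = (v q).1 := hbij.1 (hv (v q)).symm
    rw [this]
    exact (v q).2
  obtain ⟨x, hx⟩ := exists_ne (0 : X)
  obtain ⟨q, rfl⟩ := hcov.surjective x
  exact hx (htop ▸ Submodule.mem_top : q ∈ _root_.syzygy Λ X)

theorem isSyzygy_syzygy [IsArtinianRing Λ] (hX : IsNonprojectiveUniserial Λ X) :
    IsSyzygy Λ (syzygy Λ X) X := by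
  have := hX.finite
  have := hX.nontrivial
  exact ⟨(projectiveCover Λ X).1, (syzygy Λ X).subtype, projCoverMap Λ X,
    isPrincipalIndecomposable_projCover hX.uniserial, Submodule.injective_subtype _,
    LinearMap.exact_subtype_ker_map _, (isProjectiveCover_projCoverMap Λ X).surjective⟩

/-- `β ∘ α` lifts the identity of `X` to its projective cover, so it is an automorphism. Its
restriction to `ΩX` is injective and hence, by the artinian property, bijective. -/
theorem IsGorensteinRetract.syzygy [IsArtinianRing Λ]
    (hX : IsNonprojectiveUniserial Λ X) (hG : IsGorensteinRetract Λ X) :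
    IsGorensteinRetract Λ (syzygy Λ X) := by
  have := hX.finite
  have := hX.nontrivial
  have hcov := isProjectiveCover_projCoverMap Λ X
  have hQ := isPrincipalIndecomposable_projCover hX.uniserial
  have := hQ.finite
  have := hQ.projective
  obtain ⟨P, d, hd, j, s, r, hrs⟩ := hG
  have := hd.projective (j + 1)
  set p := projCoverMap Λ X with hpdef
  obtain ⟨α, hα⟩ := Module.projective_lifting_property (d j).rangeRestrict (s ∘ₗ p)
    (d j).surjective_rangeRestrict
  obtain ⟨β, hβ⟩ := Module.projective_lifting_property p (r ∘ₗ (d j).rangeRestrict)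
    hcov.surjective
  have hα' : ∀ q, (d j).rangeRestrict (α q) = s (p q) := fun q => LinearMap.congr_fun hα q
  have hβ' : ∀ y, p (β y) = r ((d j).rangeRestrict y) := fun y => LinearMap.congr_fun hβ y
  have hrs' : ∀ x, r (s x) = x := fun x => LinearMap.congr_fun hrs x
  have hker : ∀ y ∈ LinearMap.range (d (j + 1)), β y ∈ LinearMap.ker p := by
    rintro _ ⟨z, rfl⟩
    have : (d j).rangeRestrict (d (j + 1) z) = 0 :=
      Subtype.ext ((hd.exact j).apply_apply_eq_zero z)
    rw [LinearMap.mem_ker, hβ', this, map_zero]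
  have hαk : ∀ q ∈ LinearMap.ker p, α q ∈ LinearMap.range (d (j + 1)) := by
    intro q hq
    refine ((hd.exact j) (α q)).mp ?_
    have h1 := congrArg Subtype.val (hα' q)
    rw [hq, map_zero] at h1
    exact h1
  have hsurj : Function.Surjective (β ∘ₗ α) := by
    rw [← LinearMap.range_eq_top]
    apply hcov.superfluous
    rw [eq_top_iff]
    intro q _
    rw [← add_sub_cancel ((β ∘ₗ α) q) q]
    refine Submodule.add_mem_sup ⟨q, rfl⟩ ?_
    rw [LinearMap.mem_ker, map_sub, LinearMap.comp_apply, hβ', hα', hrs']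
    exact sub_self _
  have hinj : Function.Injective (β ∘ₗ α) :=
    IsNoetherian.injective_of_surjective_endomorphism _ hsurj
  refine hd.isGorensteinRetract (j + 1) (α.restrict hαk) (β.restrict hker) ?_
  refine IsArtinian.bijective_of_injective_endomorphism
    (β.restrict hker ∘ₗ α.restrict hαk : LinearMap.ker p →ₗ[Λ] LinearMap.ker p) ?_
  intro x y hxy
  exact Subtype.ext (hinj (congrArg Subtype.val hxy))

/-- Were `rad P(X)` projective, the inclusion `ΩX → rad P(X)` would extend to `P(X)`. The extension
is injective since its kernel avoids `ΩX`, but an injective endomorphism of `P(X)` cannot have a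
proper image. -/
theorem isBlack_top_of_isGorensteinRetract [IsArtinianRing Λ] (hl : IsLeftSerial Λ)
    (hX : IsNonprojectiveUniserial Λ X) (hG : IsGorensteinRetract Λ X) :
    IsBlack Λ (ModuleTop Λ X) := by
  have := hX.finite
  have := hX.nontrivial
  have := hX.uniserial.isSimpleModule_top
  have hcov := isProjectiveCover_projCoverMap Λ X
  have hQ := isPrincipalIndecomposable_projCover hX.uniserial
  have := hQ.finite
  have := hQ.projective
  let f : ProjCover Λ X →ₗ[Λ] ModuleTop Λ X := (Module.jacobson Λ X).mkQ ∘ₗ projCoverMap Λ X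
  have hf : Function.Surjective f := (Submodule.mkQ_surjective _).comp hcov.surjective
  rw [isBlack_iff_not_projective_ker hf]
  intro hproj
  have hn := nontrivial_syzygy hX.not_projective
  have hle : syzygy Λ X ≤ LinearMap.ker f := LinearMap.ker_le_ker_comp _ _
  have hJ : IsUniserial Λ (LinearMap.ker f) :=
    (hQ.uniserial hl).of_injective (Submodule.injective_subtype _)
  have : Nontrivial (LinearMap.ker f) :=
    (Submodule.inclusion_injective hle).nontrivial
  have hJP : IsPrincipalIndecomposable Λ (LinearMap.ker f) :=
    ⟨inferInstance, hproj, hJ.isIndecomposable⟩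
  obtain ⟨a, b, hab⟩ := hJP.exists_retraction hl
  obtain ⟨v, hv⟩ := exists_extension_of_retraction (i := (syzygy Λ X).subtype)
    (fun u => hG.exists_extension hcov.surjective u) hab (Submodule.inclusion hle)
  have hinj : LinearMap.ker ((LinearMap.ker f).subtype ∘ₗ v) = ⊥ := by
    refine (hQ.uniserial hl).eq_bot_of_inf_eq_bot (B := syzygy Λ X) ?_
      (Submodule.nontrivial_iff_ne_bot.mp hn)
    rw [eq_bot_iff]
    rintro q ⟨hq, hqK⟩
    have h1 : v q = Submodule.inclusion hle ⟨q, hqK⟩ := hv ⟨q, hqK⟩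
    change (v q).1 = 0 at hq
    rw [h1] at hq
    exact hq
  have hsurj := (IsArtinian.bijective_of_injective_endomorphism _
    (LinearMap.ker_eq_bot.mp hinj)).2
  apply (isCoatom_ker_of_surjective hf).1
  rw [eq_top_iff]
  intro q _
  obtain ⟨q', rfl⟩ := hsurj q
  exact (v q').2

end Gorenstein

/-! ### Left approximations and cosyzygies -/

section Cosyzygy

variable {Λ : Type u} [Ring Λ] {X A P : Type u} [AddCommGroup X] [Module Λ X]
  [AddCommGroup A] [Module Λ A] [AddCommGroup P] [Module Λ P]

/-- A uniserial module has a left approximation by a principal indecomposable module. -/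
theorem IsUniserial.exists_left_approximation [IsArtinianRing Λ] [IsNoetherianRing Λᵐᵒᵖ]
    (hl : IsLeftSerial Λ) (hr : IsLeftSerial Λᵐᵒᵖ) (hX : IsUniserial Λ X) [Module.Finite Λ X]
    [Nontrivial X] : ∃ (A : ModuleCat.{u} Λ) (g : X →ₗ[Λ] A), IsPrincipalIndecomposable Λ A ∧
      ∀ u : X →ₗ[Λ] Λ, ∃ h : A →ₗ[Λ] Λ, u = h ∘ₗ g := by
  have hQ := isPrincipalIndecomposable_projCover hX
  have := (hQ.dual hl).finite
  have hcov := isProjectiveCover_projCoverMap Λ X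
  set p := projCoverMap Λ X
  -- `g` is chosen so that `i ∘ g ∘ p` generates a maximal submodule of the noetherian right module
  -- `Hom(P(X), Λ)`. A map through which `g` factors generates at least as much, so by maximality it
  -- factors through `g` in turn.
  obtain ⟨_, ⟨A, g, i, r, hA, hri, rfl⟩, hmax⟩ := WellFounded.has_min
    (wellFounded_gt : WellFounded
      (fun A B : Submodule Λᵐᵒᵖ (ProjCover Λ X →ₗ[Λ] Λ) => A > B))
    {W | ∃ (A : ModuleCat.{u} Λ) (g : X →ₗ[Λ] A) (i : A →ₗ[Λ] Λ) (r : Λ →ₗ[Λ] A),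
      IsPrincipalIndecomposable Λ A ∧ r ∘ₗ i = LinearMap.id ∧
      W = Submodule.span Λᵐᵒᵖ {i ∘ₗ g ∘ₗ p}} (by
        obtain ⟨i, r, hri⟩ := hQ.exists_retraction hl
        exact ⟨_, (projectiveCover Λ X).1, 0, i, r, hQ, hri, rfl⟩)
  refine ⟨A, g, hA, fun u => ?_⟩
  let W : AddSubgroup (X →ₗ[Λ] Λ) :=
    { carrier := {u | ∃ h : A →ₗ[Λ] Λ, u = h ∘ₗ g}
      add_mem' := by
        rintro _ _ ⟨v, rfl⟩ ⟨w, rfl⟩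
        exact ⟨v + w, (LinearMap.add_comp _ _ _).symm⟩
      zero_mem' := ⟨0, (LinearMap.zero_comp _).symm⟩
      neg_mem' := by
        rintro _ ⟨v, rfl⟩
        exact ⟨-v, (LinearMap.neg_comp _ _).symm⟩ }
  have hcancel : ∀ {Z : Type u} [AddCommGroup Z] [Module Λ Z] {u v : X →ₗ[Λ] Z},
      u ∘ₗ p = v ∘ₗ p → u = v := by
    intro Z _ _ u v h
    exact (LinearMap.cancel_right hcov.surjective).mp h
  refine mem_of_principal_retracts W u fun B r' i' hB => ?_
  suffices h : ∃ h : A →ₗ[Λ] B, r' ∘ₗ u = h ∘ₗ g by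
    obtain ⟨h, hh⟩ := h
    exact ⟨i' ∘ₗ h, by rw [hh]; rfl⟩
  rcases hQ.exists_eq_comp_or hB hA hl hr ((r' ∘ₗ u) ∘ₗ p) (g ∘ₗ p) with ⟨h, hh⟩ | ⟨h, hh⟩
  · exact ⟨h, hcancel hh⟩
  obtain ⟨j, ρ, hρ⟩ := hB.exists_retraction hl
  have hle : Submodule.span Λᵐᵒᵖ {i ∘ₗ g ∘ₗ p} ≤
      Submodule.span Λᵐᵒᵖ {j ∘ₗ (r' ∘ₗ u) ∘ₗ p} := by
    rw [Submodule.span_singleton_le_iff_mem, Submodule.mem_span_singleton]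
    refine ⟨MulOpposite.op ((i ∘ₗ h ∘ₗ ρ) 1), LinearMap.ext fun q => ?_⟩
    change j (r' (u (p q))) • (i ∘ₗ h ∘ₗ ρ) 1 = i (g (p q))
    rw [← map_smul, smul_eq_mul, mul_one]
    change i (h ((ρ ∘ₗ j) (r' (u (p q))))) = i (g (p q))
    rw [hρ]
    exact congrArg i (LinearMap.congr_fun hh q).symm
  have heq : Submodule.span Λᵐᵒᵖ {i ∘ₗ g ∘ₗ p} =
      Submodule.span Λᵐᵒᵖ {j ∘ₗ (r' ∘ₗ u) ∘ₗ p} := by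
    by_contra hne
    exact hmax _ ⟨B, r' ∘ₗ u, j, ρ, hB, hρ, rfl⟩ (lt_of_le_of_ne hle hne)
  obtain ⟨c, hc⟩ := exists_comp_eq_of_mem_span
    (heq ▸ Submodule.mem_span_singleton_self (j ∘ₗ (r' ∘ₗ u) ∘ₗ p))
  refine ⟨ρ ∘ₗ c ∘ₗ i, hcancel ?_⟩
  refine LinearMap.ext fun q => ?_
  have h1 := congrArg ρ (LinearMap.congr_fun hc q)
  change (ρ ∘ₗ j) (r' (u (p q))) = _ at h1
  rw [hρ] at h1
  exact h1

theorem exists_eq_comp_of_forall [Module.Projective Λ P] [Module.Finite Λ P] {g : X →ₗ[Λ] A}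
    (hg : ∀ u : X →ₗ[Λ] Λ, ∃ h : A →ₗ[Λ] Λ, u = h ∘ₗ g) (u : X →ₗ[Λ] P) :
    ∃ h : A →ₗ[Λ] P, u = h ∘ₗ g := by
  obtain ⟨n, π, hπ⟩ := Module.Finite.exists_fin' Λ P
  obtain ⟨σ, hσ⟩ := Module.projective_lifting_property π LinearMap.id hπ
  choose h hh using fun k : Fin n => hg (LinearMap.proj k ∘ₗ σ ∘ₗ u)
  refine ⟨π ∘ₗ LinearMap.pi h, LinearMap.ext fun x => ?_⟩
  have h1 : σ (u x) = LinearMap.pi h (g x) := funext fun k => LinearMap.congr_fun (hh k) x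
  change u x = π (LinearMap.pi h (g x))
  rw [← h1]
  exact (LinearMap.congr_fun hσ (u x)).symm

/-- An indecomposable non-projective Gorenstein projective module is a syzygy module of such a
module. -/
theorem IsGorensteinRetract.exists_isSyzygy [IsArtinianRing Λ] [IsNoetherianRing Λᵐᵒᵖ]
    (hl : IsLeftSerial Λ) (hr : IsLeftSerial Λᵐᵒᵖ) (hX : IsNonprojectiveUniserial Λ X)
    (hG : IsGorensteinRetract Λ X) : ∃ N : ModuleCat.{u} Λ, IsNonprojectiveUniserial Λ N ∧
      IsGorensteinRetract Λ N ∧ IsSyzygy Λ X N := by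
  have := hX.finite
  have := hX.nontrivial
  obtain ⟨A, g, hA, hg⟩ := hX.uniserial.exists_left_approximation hl hr
  have := hA.finite
  have := hA.projective
  have hAu := hA.uniserial hl
  obtain ⟨P, d, hd, j, s, r, hrs⟩ := hG
  -- `X` is a retract of an image inside `P (k + 1)`; its cosyzygy will be a retract of the image of
  -- `d k`.
  obtain ⟨k, rfl⟩ : ∃ k, j = k + 1 := ⟨j - 1, by ring⟩
  have hrs' : ∀ x, r (s x) = x := fun x => LinearMap.congr_fun hrs x
  have := hd.projective (k + 1)
  have := hd.finite (k + 1)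
  obtain ⟨α, hα⟩ := exists_eq_comp_of_forall hg ((LinearMap.range (d (k + 1))).subtype ∘ₗ s)
  have hα' : ∀ x, α (g x) = (s x).1 := fun x => (LinearMap.congr_fun hα x).symm
  have hginj : Function.Injective g := by
    intro x y hxy
    rw [← hrs' x, ← hrs' y]
    congr 1
    apply Subtype.ext
    rw [← hα', ← hα', hxy]
  obtain ⟨a, b, hab⟩ := hA.exists_retraction hl
  obtain ⟨β, hβ⟩ := exists_extension_of_retraction (i := (LinearMap.range (d (k + 1))).subtype)
    (fun u => hd.exists_extension (k + 1) u) hab (g ∘ₗ r)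
  -- As `β ∘ α` fixes `g(X)`, it is injective on the uniserial module `A`, hence an automorphism. It
  -- induces `r' ∘ s'` on `A / g(X)`, which is therefore surjective and then bijective.
  have hβα : ∀ x, β (α (g x)) = g x := fun x => by
    rw [hα']
    exact (hβ (s x)).trans (congrArg g (hrs' x))
  have hgbot : LinearMap.range g ≠ ⊥ := by
    intro h
    obtain ⟨x, hx⟩ := exists_ne (0 : X)
    exact hx (hginj (by rw [LinearMap.range_eq_bot.mp h]; rfl))
  have hinj : Function.Injective (β ∘ₗ α) := by
    rw [← LinearMap.ker_eq_bot]
    refine hAu.eq_bot_of_inf_eq_bot (B := LinearMap.range g) ?_ hgbot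
    rw [eq_bot_iff]
    rintro _ ⟨hx, x, rfl⟩
    exact (hβα x).symm.trans hx
  have hsurj := (IsArtinian.bijective_of_injective_endomorphism _ hinj).2
  have hgtop : LinearMap.range g ≠ ⊤ := by
    intro h
    exact hX.not_projective (Module.Projective.of_equiv
      (LinearEquiv.ofBijective g ⟨hginj, LinearMap.range_eq_top.mp h⟩).symm)
  have hNnt : Nontrivial (A ⧸ LinearMap.range g) := Submodule.Quotient.nontrivial_iff.mpr hgtop
  have hNu : IsUniserial Λ (A ⧸ LinearMap.range g) :=
    hAu.of_surjective (Submodule.mkQ_surjective _)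
  refine ⟨ModuleCat.of Λ (A ⧸ LinearMap.range g), ⟨inferInstance, hNu, hNnt, fun hproj => ?_⟩, ?_,
    A, g, (LinearMap.range g).mkQ, hA, hginj, LinearMap.exact_map_mkQ_range g,
    Submodule.mkQ_surjective _⟩
  · have hb := hA.indecomposable.bijective_of_surjective
      (Submodule.mkQ_surjective (LinearMap.range g))
    have h1 := LinearMap.ker_eq_bot.mpr hb.1
    rw [Submodule.ker_mkQ] at h1
    exact hgbot h1
  let s' : (A ⧸ LinearMap.range g) →ₗ[Λ] LinearMap.range (d k) :=
    (LinearMap.range g).liftQ ((d k).rangeRestrict ∘ₗ α) (by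
      rintro _ ⟨x, rfl⟩
      refine Subtype.ext ?_
      change d k (α (g x)) = 0
      rw [hα']
      exact ((hd.exact k) _).mpr (s x).2)
  have hle : LinearMap.ker (d k) ≤ LinearMap.ker ((LinearMap.range g).mkQ ∘ₗ β) := by
    intro y hy
    have hy' : y ∈ LinearMap.range (d (k + 1)) := ((hd.exact k) y).mp hy
    have h1 : β y = g (r ⟨y, hy'⟩) := hβ ⟨y, hy'⟩
    change (LinearMap.range g).mkQ (β y) = 0
    rw [h1]
    exact (Submodule.Quotient.mk_eq_zero _).mpr ⟨_, rfl⟩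
  let r' : LinearMap.range (d k) →ₗ[Λ] (A ⧸ LinearMap.range g) :=
    (LinearMap.ker (d k)).liftQ ((LinearMap.range g).mkQ ∘ₗ β) hle ∘ₗ (d k).quotKerEquivRange.symm.toLinearMap
  have hr' : ∀ y, r' ((d k).rangeRestrict y) = (LinearMap.range g).mkQ (β y) := by
    intro y
    have h1 : (d k).quotKerEquivRange.symm ((d k).rangeRestrict y) =
        (LinearMap.ker (d k)).mkQ y := by
      rw [LinearEquiv.symm_apply_eq]
      exact Subtype.ext rfl
    exact congrArg ((LinearMap.ker (d k)).liftQ ((LinearMap.range g).mkQ ∘ₗ β) hle) h1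
  have hcomp : ∀ z, (r' ∘ₗ s') ((LinearMap.range g).mkQ z) =
      (LinearMap.range g).mkQ ((β ∘ₗ α) z) := fun z => hr' (α z)
  have hsurj' : Function.Surjective (r' ∘ₗ s') := by
    intro y
    obtain ⟨z, rfl⟩ := Submodule.mkQ_surjective _ y
    obtain ⟨w, rfl⟩ := hsurj z
    exact ⟨_, hcomp w⟩
  exact hd.isGorensteinRetract k s' r'
    ⟨IsNoetherian.injective_of_surjective_endomorphism _ hsurj', hsurj'⟩

end Cosyzygy

/-! ### Black cycles from infinite backward walks -/

section Cycles

variable {R Λ : Type u} [CommRing R] [Ring Λ] [Algebra R Λ] {S T X : Type u}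
  [AddCommGroup S] [Module Λ S] [AddCommGroup T] [Module Λ T] [AddCommGroup X] [Module Λ X]

theorem IsCyclicallyBlack.congr (h : IsCyclicallyBlack R Λ S) (e : S ≃ₗ[Λ] T) :
    IsCyclicallyBlack R Λ T := by
  obtain ⟨n, c, hc, i, ⟨f⟩⟩ := h
  exact ⟨n, c, hc, i, ⟨e.symm.trans f⟩⟩

theorem IsCyclicallyBlack.isSimpleModule (h : IsCyclicallyBlack R Λ S) : IsSimpleModule Λ S := by
  obtain ⟨n, c, hc, i, ⟨f⟩⟩ := h
  have := hc.simple i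
  exact IsSimpleModule.congr f

/-- `γ` maps isomorphic simple modules to isomorphic modules. -/
theorem ResolutionArrow.nonempty_equiv [IsArtinianRing R] [Module.Finite R Λ]
    [IsArtinianRing Λ] (hl : IsLeftSerial Λ) (hr : IsLeftSerial Λᵐᵒᵖ)
    (hns : NoSimpleProjective Λ) {S' T' : Type u} [AddCommGroup S'] [Module Λ S']
    [AddCommGroup T'] [Module Λ T'] [IsSimpleModule Λ S] (h : ResolutionArrow R Λ S T)
    (h' : ResolutionArrow R Λ S' T') (e : S ≃ₗ[Λ] S') : Nonempty (T ≃ₗ[Λ] T') := by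
  obtain ⟨a⟩ := h.congr hl hr hns e (LinearEquiv.refl Λ T)
  obtain ⟨b⟩ := h'
  exact ⟨a.trans b.symm⟩

/-- A black vertex from which infinite backward walks through black vertices start lies on a
black cycle. -/
theorem isCyclicallyBlack_of_sequence [IsArtinianRing R] [Module.Finite R Λ]
    [IsArtinianRing Λ] (hl : IsLeftSerial Λ) (hr : IsLeftSerial Λᵐᵒᵖ)
    (hns : NoSimpleProjective Λ) (T : ℕ → ModuleCat.{u} Λ) (hT : ∀ k, IsSimpleModule Λ (T k))
    (hblack : ∀ k, IsBlack Λ (T k)) (harrow : ∀ k, ResolutionArrow R Λ (T (k + 1)) (T k)) :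
    IsCyclicallyBlack R Λ (T 0) := by
  classical
  -- Since γ respects isomorphism classes, a repetition at indices `i` and `i + m` is carried along
  -- the arrows to the indices `0` and `m`.
  have hback : ∀ i m, Nonempty (T i ≃ₗ[Λ] T (i + m)) → Nonempty (T 0 ≃ₗ[Λ] T m) := by
    intro i
    induction i with
    | zero =>
      intro m h
      rwa [zero_add] at h
    | succ i ih =>
      rintro m ⟨e⟩
      have := hT (i + 1)
      refine ih m ((harrow i).nonempty_equiv hl hr hns (harrow (i + m)) ?_)
      rwa [Nat.add_right_comm] at e
  obtain ⟨i, j, hij, he⟩ := exists_lt_nonempty_equiv_of_isSimpleModule hl T hT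
  have hex : ∃ n, Nonempty (T 0 ≃ₗ[Λ] T (n + 1)) := by
    obtain ⟨n, rfl⟩ := Nat.exists_eq_add_of_lt hij
    exact ⟨n, hback i (n + 1) (by rwa [← add_assoc])⟩
  obtain ⟨e⟩ := Nat.find_spec hex
  have hmin := fun m => Nat.find_min (H := hex) (m := m)
  generalize Nat.find hex = n at e hmin
  have hne : ∀ a m, a + m + 1 ≤ n → ¬ Nonempty (T a ≃ₗ[Λ] T (a + (m + 1))) :=
    fun a m h1 h2 => hmin m (by omega) (hback a _ h2)
  have hlt : ∀ i j : Fin (n + 1), i < j →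
      ¬ Nonempty (T (n + 1 - i) ≃ₗ[Λ] T (n + 1 - j)) := by
    rintro i j hij ⟨f⟩
    have hij' : i.val < j.val := hij
    by_cases hi : i.val = 0
    · have h1 : n + 1 - j.val = (n - j.val) + 1 := by omega
      rw [hi, Nat.sub_zero, h1] at f
      exact hmin _ (by omega) ⟨e.trans f⟩
    · have h1 : n + 1 - i.val = (n + 1 - j.val) + ((j.val - i.val - 1) + 1) := by omega
      rw [h1] at f
      exact hne _ _ (by omega) ⟨f.symm⟩
  -- Arrows lower the index of `T`, so the cycle runs from `T (n + 1) ≅ T 0` down to `T 1`.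
  -- Minimality of `n` gives distinct vertices, and the arrow `T 1 → T 0` closes the cycle through
  -- `e`.
  refine ⟨n, fun i => T (n + 1 - i), ⟨fun i => hT _, fun i j h => ?_, fun i => ?_,
    fun i => hblack _⟩, 0, ⟨e⟩⟩
  · by_contra hcon
    rcases lt_or_gt_of_ne hcon with h1 | h1
    · exact hlt i j h1 h
    · exact hlt j i h1 ⟨h.some.symm⟩
  · by_cases hi : i = Fin.last n
    · have := hT (0 + 1)
      have h1 : n + 1 - ((i + 1 : Fin (n + 1)) : ℕ) = n + 1 := by simp [hi]
      have h2 : n + 1 - (i : ℕ) = 0 + 1 := by simp [hi]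
      rw [h1, h2]
      exact (harrow 0).congr hl hr hns (LinearEquiv.refl Λ _) e
    · have h1 : ((i + 1 : Fin (n + 1)) : ℕ) = i + 1 := Fin.val_add_one_of_lt
        (lt_of_le_of_ne (Fin.le_last i) hi)
      have h2 : n + 1 - i.val = (n + 1 - (i.val + 1)) + 1 := by omega
      rw [h1, h2]
      exact harrow _

theorem IsGorensteinRetract.isCyclicallyBlack_top [IsArtinianRing R] [Module.Finite R Λ]
    [IsArtinianRing Λ] [IsNoetherianRing Λᵐᵒᵖ] (hl : IsLeftSerial Λ) (hr : IsLeftSerial Λᵐᵒᵖ)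
    (hns : NoSimpleProjective Λ) (hX : IsNonprojectiveUniserial Λ X)
    (hG : IsGorensteinRetract Λ X) : IsCyclicallyBlack R Λ (ModuleTop Λ X) := by
  let V := {N : ModuleCat.{u} Λ // IsNonprojectiveUniserial Λ N ∧ IsGorensteinRetract Λ N}
  have hex : ∀ N : V, ∃ N' : V, IsSyzygy Λ N.1 N'.1 := by
    rintro ⟨N, hN, hG⟩
    obtain ⟨N', h1, h2, h3⟩ := hG.exists_isSyzygy hl hr hN
    exact ⟨⟨N', h1, h2⟩, h3⟩
  choose next hnext using hex
  let N : ℕ → V := fun k => next^[k] ⟨ModuleCat.of Λ X, hX, hG⟩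
  have hN : ∀ k, IsSyzygy Λ (N k).1 (N (k + 1)).1 := by
    intro k
    have : N (k + 1) = next (N k) := Function.iterate_succ_apply' _ _ _
    rw [this]
    exact hnext _
  -- One arrow corresponds to two syzygy steps, whence the indices `2 * k`.
  refine isCyclicallyBlack_of_sequence hl hr hns
    (fun k => ModuleCat.of Λ (ModuleTop Λ (N (2 * k)).1)) (fun k => ?_) (fun k => ?_) (fun k => ?_)
  · have := (N (2 * k)).2.1.finite
    have := (N (2 * k)).2.1.nontrivial
    exact (N (2 * k)).2.1.uniserial.isSimpleModule_top
  · exact isBlack_top_of_isGorensteinRetract hl (N (2 * k)).2.1 (N (2 * k)).2.2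
  · have := (N (2 * k)).2.1.nontrivial
    have := (N (2 * k + 1)).2.1.nontrivial
    have := (N (2 * k + 1 + 1)).2.1.nontrivial
    exact (hN (2 * k)).resolutionArrow hl hr hns (hN (2 * k + 1))

end Cycles

/-! ### Uniserial modules with isomorphic radicals or socles -/

section Comparison

variable {R Λ : Type u} [CommRing R] [Ring Λ] [Algebra R Λ] {U V : Type u}
  [AddCommGroup U] [Module Λ U] [AddCommGroup V] [Module Λ V]

theorem LinearMap.exists_comp_eq_of_ker_le {P : Type u} [AddCommGroup P] [Module Λ P]
    {f : P →ₗ[Λ] U} {g : P →ₗ[Λ] V} (hf : Function.Surjective f)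
    (h : LinearMap.ker f ≤ LinearMap.ker g) : ∃ q : U →ₗ[Λ] V, ∀ x, q (f x) = g x := by
  refine ⟨(LinearMap.ker f).liftQ g h ∘ₗ (f.quotKerEquivOfSurjective hf).symm.toLinearMap,
    fun x => ?_⟩
  have h1 : (f.quotKerEquivOfSurjective hf).symm (f x) = (LinearMap.ker f).mkQ x := by
    rw [LinearEquiv.symm_apply_eq]
    rfl
  exact congrArg ((LinearMap.ker f).liftQ g h) h1

/-- `q` restricts to a surjection between the isomorphic noetherian modules `K` and `L`, which is
injective. So `ker q` avoids the non-zero submodule `K` and vanishes. -/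
theorem IsUniserial.bijective_of_surjective_of_isCoatom (hU : IsUniserial Λ U) [Module.Finite Λ U]
    [IsNoetherianRing Λ] {K : Submodule Λ U} {L : Submodule Λ V} (hK : IsCoatom K)
    (hL : IsCoatom L) (hK0 : K ≠ ⊥) (e : K ≃ₗ[Λ] L) {q : U →ₗ[Λ] V}
    (hq : Function.Surjective q) : Function.Bijective q := by
  have hqK : K = L.comap q := by
    have h1 : IsCoatom (L.comap q) := by
      have : IsSimpleModule Λ (V ⧸ L) := isSimpleModule_iff_isCoatom.mpr hL
      have h2 := isCoatom_ker_of_surjective (f := L.mkQ ∘ₗ q)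
        ((Submodule.mkQ_surjective L).comp hq)
      rwa [LinearMap.ker_comp, Submodule.ker_mkQ] at h2
    rw [← hU.jacobson_eq hK, ← hU.jacobson_eq h1]
  let k : K →ₗ[Λ] L := q.restrict fun x hx => by rw [hqK] at hx; exact hx
  have hk : Function.Surjective k := by
    rintro ⟨y, hy⟩
    obtain ⟨x, rfl⟩ := hq y
    exact ⟨⟨x, by rw [hqK]; exact hy⟩, rfl⟩
  have hinj : Function.Injective (e.symm.toLinearMap ∘ₗ k) :=
    IsNoetherian.injective_of_surjective_endomorphism _ (e.symm.surjective.comp hk)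
  refine ⟨LinearMap.ker_eq_bot.mp (hU.eq_bot_of_inf_eq_bot (B := K) ?_ hK0), hq⟩
  rw [eq_bot_iff]
  rintro x ⟨hx, hxK⟩
  have h1 : k ⟨x, hxK⟩ = 0 := Subtype.ext hx
  have h2 : (⟨x, hxK⟩ : K) = 0 := hinj (by rw [LinearMap.comp_apply, h1]; simp)
  exact congrArg Subtype.val h2

theorem IsUniserial.nonempty_top_equiv_translate_top [IsArtinianRing R] [Module.Finite R Λ]
    [IsArtinianRing Λ] (hl : IsLeftSerial Λ) (hr : IsLeftSerial Λᵐᵒᵖ)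
    (hns : NoSimpleProjective Λ) (hU : IsUniserial Λ U) [Module.Finite Λ U] {K : Submodule Λ U}
    (hK : IsCoatom K) (hK0 : K ≠ ⊥) :
    Nonempty (ModuleTop Λ K ≃ₗ[Λ] ARTranslate R Λ (ModuleTop Λ U)) := by
  have : IsSimpleModule Λ (ModuleTop Λ U) := by
    rw [isSimpleModule_iff_isCoatom, hU.jacobson_eq hK]
    exact hK
  have hker : LinearMap.ker (Module.jacobson Λ U).mkQ = K := by
    rw [Submodule.ker_mkQ, hU.jacobson_eq hK]
  obtain ⟨e⟩ := nonempty_top_ker_equiv_translate (R := R) hl hr hns hU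
    (Submodule.mkQ_surjective (Module.jacobson Λ U)) (by rwa [hker])
  rw [hker] at e
  exact ⟨e⟩

/-- A uniserial module is determined by its radical, if the radical is not zero. -/
theorem IsUniserial.nonempty_equiv_of_coatom_equiv [IsArtinianRing R] [Module.Finite R Λ]
    [IsArtinianRing Λ] (hl : IsLeftSerial Λ) (hr : IsLeftSerial Λᵐᵒᵖ)
    (hns : NoSimpleProjective Λ) (hU : IsUniserial Λ U) [Module.Finite Λ U]
    (hV : IsUniserial Λ V) [Module.Finite Λ V] {K : Submodule Λ U} {L : Submodule Λ V}
    (hK : IsCoatom K) (hL : IsCoatom L) (hK0 : K ≠ ⊥) (e : K ≃ₗ[Λ] L) :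
    Nonempty (U ≃ₗ[Λ] V) := by
  have hKn : Nontrivial K := Submodule.nontrivial_iff_ne_bot.mpr hK0
  have hLn : Nontrivial L := e.symm.toEquiv.nontrivial
  have hL0 : L ≠ ⊥ := Submodule.nontrivial_iff_ne_bot.mp hLn
  have : Nontrivial U := (Submodule.injective_subtype K).nontrivial
  have : Nontrivial V := (Submodule.injective_subtype L).nontrivial
  have := hU.isSimpleModule_top
  have := hV.isSimpleModule_top
  obtain ⟨a⟩ := hU.nonempty_top_equiv_translate_top (R := R) hl hr hns hK hK0
  obtain ⟨b⟩ := hV.nonempty_top_equiv_translate_top (R := R) hl hr hns hL hL0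
  obtain ⟨c⟩ := (hU.of_injective K.injective_subtype).nonempty_top_equiv_top
    (f := e.toLinearMap) e.surjective
  -- The radicals have tops `τ top U` and `τ top V`, so injectivity of τ gives `top U ≅ top V`. Both
  -- modules are then quotients of `P(U)`, and comparing the kernels gives a surjection from one to
  -- the other.
  obtain ⟨t⟩ := nonempty_equiv_of_translate_equiv (R := R) hl hr hns
    ((a.symm.trans c).trans b)
  have hcov := isProjectiveCover_projCoverMap Λ U
  have hP := isPrincipalIndecomposable_projCover hU
  have := hP.finite
  have := hP.projective
  obtain ⟨s⟩ := (hP.uniserial hl).nonempty_top_equiv_top hcov.surjective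
  obtain ⟨f, hf⟩ := hV.exists_surjective_of_top_equiv (P := ProjCover Λ U) (s.trans t)
  rcases hP.uniserial hl (LinearMap.ker (projCoverMap Λ U)) (LinearMap.ker f) with h | h
  · obtain ⟨q, hq'⟩ := LinearMap.exists_comp_eq_of_ker_le hcov.surjective h
    have hq : Function.Surjective q := fun y => by
      obtain ⟨p, rfl⟩ := hf y
      exact ⟨_, hq' p⟩
    exact ⟨LinearEquiv.ofBijective q
      (hU.bijective_of_surjective_of_isCoatom hK hL hK0 e hq)⟩
  · obtain ⟨q, hq'⟩ := LinearMap.exists_comp_eq_of_ker_le hf h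
    have hq : Function.Surjective q := fun y => by
      obtain ⟨p, rfl⟩ := hcov.surjective y
      exact ⟨_, hq' p⟩
    exact ⟨(LinearEquiv.ofBijective q
      (hV.bijective_of_surjective_of_isCoatom hL hK hL0 e.symm hq)).symm⟩

/-- Of two uniserial modules with isomorphic socles, one embeds into the other. -/
theorem IsUniserial.exists_injective_or [IsArtinianRing R] [Module.Finite R Λ]
    [IsArtinianRing Λ] (hl : IsLeftSerial Λ) (hr : IsLeftSerial Λᵐᵒᵖ)
    (hns : NoSimpleProjective Λ) (hU : IsUniserial Λ U) [Module.Finite Λ U] [Nontrivial U]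
    (hV : IsUniserial Λ V) [Module.Finite Λ V] (e : socle Λ U ≃ₗ[Λ] socle Λ V) :
    (∃ f : U →ₗ[Λ] V, Function.Injective f) ∨ ∃ f : V →ₗ[Λ] U, Function.Injective f := by
  -- `K` is maximal among the submodules containing the socle that embed in `V`. If `K` and its
  -- image are both proper, the next larger submodules `U'` and `V'` have isomorphic non-zero
  -- radicals, so they are isomorphic, against maximality.
  obtain ⟨K, ⟨hsK, j, hj⟩, hmax⟩ := WellFounded.has_min
    (wellFounded_gt : WellFounded (fun A B : Submodule Λ U => A > B))
    {K | socle Λ U ≤ K ∧ ∃ j : K →ₗ[Λ] V, Function.Injective j}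
    ⟨socle Λ U, le_rfl, (socle Λ V).subtype ∘ₗ e.toLinearMap,
      (Submodule.injective_subtype _).comp e.injective⟩
  have hs := hU.isSimpleModule_socle
  have hs0 : socle Λ U ≠ ⊥ := (isSimpleModule_iff_isAtom.mp hs).1
  have hK0 : K ≠ ⊥ := fun h => hs0 (le_bot_iff.mp (h ▸ hsK))
  by_cases hKtop : K = ⊤
  · subst hKtop
    exact Or.inl ⟨j ∘ₗ Submodule.topEquiv.symm.toLinearMap,
      hj.comp Submodule.topEquiv.symm.injective⟩
  by_cases hjs : Function.Surjective j
  · let i := LinearEquiv.ofBijective j ⟨hj, hjs⟩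
    exact Or.inr ⟨K.subtype ∘ₗ i.symm.toLinearMap, K.injective_subtype.comp i.symm.injective⟩
  exfalso
  obtain ⟨U', hKU, -⟩ := exists_covBy_le_of_lt (lt_top_iff_ne_top.mpr hKtop)
  obtain ⟨V', hLV, -⟩ := exists_covBy_le_of_lt
    (lt_top_iff_ne_top.mpr (mt LinearMap.range_eq_top.mp hjs))
  have hKc := isSimpleModule_iff_isCoatom.mp ((covBy_iff_quot_is_simple hKU.le).mp hKU)
  have hLc := isSimpleModule_iff_isCoatom.mp ((covBy_iff_quot_is_simple hLV.le).mp hLV)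
  have eK := Submodule.comapSubtypeEquivOfLe hKU.le
  have eL := Submodule.comapSubtypeEquivOfLe hLV.le
  have hn : Nontrivial K := Submodule.nontrivial_iff_ne_bot.mpr hK0
  obtain ⟨i⟩ := (hU.of_injective U'.injective_subtype).nonempty_equiv_of_coatom_equiv (R := R)
    hl hr hns (hV.of_injective V'.injective_subtype) hKc hLc
    (Submodule.nontrivial_iff_ne_bot.mp eK.toEquiv.nontrivial)
    ((eK.trans (LinearEquiv.ofInjective j hj)).trans eL.symm)
  exact hmax U' ⟨hsK.trans hKU.le, V'.subtype ∘ₗ i.toLinearMap,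
    V'.injective_subtype.comp i.injective⟩ hKU.lt

end Comparison

/-! ### Building complete resolutions from cyclically black modules -/

section Resolution

variable {R Λ : Type u} [CommRing R] [Ring Λ] [Algebra R Λ] {S T P X N : Type u}
  [AddCommGroup S] [Module Λ S] [AddCommGroup T] [Module Λ T] [AddCommGroup X] [Module Λ X]
  [AddCommGroup P] [Module Λ P] [AddCommGroup N] [Module Λ N]

theorem IsCyclicallyBlack.not_projective_ker (h : IsCyclicallyBlack R Λ S)
    [Module.Projective Λ P] {f : P →ₗ[Λ] S} (hf : Function.Surjective f) :
    ¬ Module.Projective Λ (LinearMap.ker f) := by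
  obtain ⟨n, c, hc, i, ⟨e⟩⟩ := h
  have h1 := (isBlack_iff_not_projective_ker (f := e.toLinearMap ∘ₗ f)
    (e.surjective.comp hf)).mp (hc.black i)
  rwa [LinearEquiv.ker_comp] at h1

theorem IsCyclicallyBlack.of_arrow [IsArtinianRing R] [Module.Finite R Λ]
    [IsArtinianRing Λ] (hl : IsLeftSerial Λ) (hr : IsLeftSerial Λᵐᵒᵖ)
    (hns : NoSimpleProjective Λ) (h : IsCyclicallyBlack R Λ S)
    (harrow : ResolutionArrow R Λ S T) : IsCyclicallyBlack R Λ T := by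
  have := h.isSimpleModule
  obtain ⟨n, c, hc, i, ⟨e⟩⟩ := h
  exact ⟨n, c, hc, i + 1, harrow.nonempty_equiv hl hr hns (hc.arrow i) e⟩

theorem IsCyclicallyBlack.exists_arrow [IsArtinianRing R] [Module.Finite R Λ]
    [IsArtinianRing Λ] (hl : IsLeftSerial Λ) (hr : IsLeftSerial Λᵐᵒᵖ)
    (hns : NoSimpleProjective Λ) (h : IsCyclicallyBlack R Λ S) :
    ∃ T : ModuleCat.{u} Λ, IsCyclicallyBlack R Λ T ∧ ResolutionArrow R Λ T S := by
  obtain ⟨n, c, hc, i, ⟨e⟩⟩ := h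
  have h1 := hc.arrow (i - 1)
  rw [sub_add_cancel] at h1
  have := hc.simple (i - 1)
  exact ⟨c (i - 1), ⟨n, c, hc, i - 1, ⟨LinearEquiv.refl _ _⟩⟩,
    h1.congr hl hr hns (LinearEquiv.refl _ _) e.symm⟩

/-- Blackness of `top N` means that `rad P` is not projective, which is what the extension property
needs. -/
theorem exists_extension_of_isCyclicallyBlack_top [IsArtinianRing Λ] (hl : IsLeftSerial Λ)
    (hr : IsLeftSerial Λᵐᵒᵖ) (hP : IsPrincipalIndecomposable Λ P) [Nontrivial X] [Nontrivial N]
    (hN : IsCyclicallyBlack R Λ (ModuleTop Λ N)) {f : X →ₗ[Λ] P} {g : P →ₗ[Λ] N}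
    (hf : Function.Injective f) (hg : Function.Surjective g) (u : X →ₗ[Λ] Λ) :
    ∃ v : P →ₗ[Λ] Λ, v ∘ₗ f = u := by
  have := hP.finite
  have := hP.projective
  have := hN.isSimpleModule
  refine hP.exists_extension hl hr ?_ hf u
  have hs : Function.Surjective ((Module.jacobson Λ N).mkQ ∘ₗ g) :=
    (Submodule.mkQ_surjective _).comp hg
  rw [(hP.uniserial hl).jacobson_eq (isCoatom_ker_of_surjective hs)]
  exact hN.not_projective_ker hs

/-- A non-projective uniserial module `X` such that `top X` and `τ soc X` are cyclically black. -/
structure IsCyclicallyBlackModule (R Λ : Type u) [CommRing R] [Ring Λ] [Algebra R Λ] (X : Type u)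
    [AddCommGroup X] [Module Λ X] : Prop where
  nonprojective : IsNonprojectiveUniserial Λ X
  top : IsCyclicallyBlack R Λ (ModuleTop Λ X)
  translate_socle : IsCyclicallyBlack R Λ (ARTranslate R Λ (socle Λ X))

theorem IsCyclicallyBlackModule.syzygy [IsArtinianRing R] [Module.Finite R Λ]
    [IsArtinianRing Λ] (hl : IsLeftSerial Λ) (hr : IsLeftSerial Λᵐᵒᵖ)
    (hns : NoSimpleProjective Λ) (h : IsCyclicallyBlackModule R Λ X) :
    IsCyclicallyBlackModule R Λ (syzygy Λ X) := by
  have := h.nonprojective.finite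
  have := h.nonprojective.nontrivial
  have hXu := h.nonprojective.uniserial
  have hn := nontrivial_syzygy h.nonprojective.not_projective
  have hP := isPrincipalIndecomposable_projCover hXu
  have := hP.finite
  have := hP.projective
  have hPu := hP.uniserial hl
  have hcov := isProjectiveCover_projCoverMap Λ X
  have hs : Function.Surjective ((Module.jacobson Λ X).mkQ ∘ₗ projCoverMap Λ X) :=
    (Submodule.mkQ_surjective _).comp hcov.surjective
  have hle : _root_.syzygy Λ X ≤ LinearMap.ker ((Module.jacobson Λ X).mkQ ∘ₗ projCoverMap Λ X) :=
    LinearMap.ker_le_ker_comp _ _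
  refine ⟨⟨inferInstance, hPu.of_injective (Submodule.injective_subtype _), hn, fun hproj => ?_⟩,
    ?_, ?_⟩
  -- As `top X` is black, `rad P(X)` is not projective; being uniserial, it contains no non-zero
  -- projective submodule such as `ΩX` would be.
  · exact h.top.not_projective_ker hs ((hPu.of_injective
      (Submodule.injective_subtype _)).projective_of_injective hl
      (Submodule.inclusion_injective hle))
  · obtain ⟨a⟩ := (isSyzygy_syzygy h.nonprojective).nonempty_top_equiv_translate_socle
      (R := R) hl hr hns
    exact h.translate_socle.congr a.symm
  · have := h.top.isSimpleModule
    have ha := nonempty_translate_socle_equiv (R := R) hl hr hns hPu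
      (Submodule.injective_subtype (_root_.syzygy Λ X))
    have ht := hPu.nonempty_top_equiv_top hcov.surjective
    obtain ⟨a⟩ := ha
    obtain ⟨t⟩ := ht
    have hb := nonempty_translate_socle_equiv_resolutionMap (R := R) hl hr hns hP t
    obtain ⟨b⟩ := hb
    exact h.top.of_arrow hl hr hns ⟨a.symm.trans b⟩

theorem IsCyclicallyBlackModule.exists_isSyzygy [IsArtinianRing R] [Module.Finite R Λ]
    [IsArtinianRing Λ] (hl : IsLeftSerial Λ) (hr : IsLeftSerial Λᵐᵒᵖ)
    (hns : NoSimpleProjective Λ) (h : IsCyclicallyBlackModule R Λ X) :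
    ∃ N : ModuleCat.{u} Λ, IsCyclicallyBlackModule R Λ N ∧ IsSyzygy Λ X N := by
  have := h.nonprojective.finite
  have := h.nonprojective.nontrivial
  have hXu := h.nonprojective.uniserial
  obtain ⟨T, hT, ⟨a⟩⟩ := h.translate_socle.exists_arrow hl hr hns
  have := hT.isSimpleModule
  have hP := isPrincipalIndecomposable_projCover_of_isSimpleModule (Λ := Λ) (S := T)
  have := hP.finite
  have := hP.nontrivial
  have := hP.projective
  have hPu := hP.uniserial hl
  have := hPu.isSimpleModule_socle
  have := hXu.isSimpleModule_socle
  obtain ⟨e⟩ := nonempty_equiv_of_translate_equiv (R := R) hl hr hns a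
  -- `X` and `P(T)` have isomorphic socles; an embedding of `P(T)` in `X` would make `X` projective.
  obtain ⟨f, hf⟩ := (hXu.exists_injective_or (R := R) hl hr hns hPu e).resolve_right
    fun ⟨f, hf⟩ => h.nonprojective.not_projective (hXu.projective_of_injective hl hf)
  have hbot : LinearMap.range f ≠ ⊥ := by
    intro h0
    obtain ⟨x, hx⟩ := exists_ne (0 : X)
    exact hx (hf (by rw [LinearMap.range_eq_bot.mp h0]; rfl))
  have htop : LinearMap.range f ≠ ⊤ := fun h1 =>
    h.nonprojective.not_projective (Module.Projective.of_equiv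
      (LinearEquiv.ofBijective f ⟨hf, LinearMap.range_eq_top.mp h1⟩).symm)
  obtain ⟨N, p, hp, hker⟩ : ∃ (N : ModuleCat.{u} Λ) (p : ProjCover Λ T →ₗ[Λ] N),
      Function.Surjective p ∧ LinearMap.ker p = LinearMap.range f :=
    ⟨ModuleCat.of Λ (ProjCover Λ T ⧸ LinearMap.range f), (LinearMap.range f).mkQ,
      Submodule.mkQ_surjective _, Submodule.ker_mkQ _⟩
  have hNn : Nontrivial N := by
    by_contra hcon
    rw [not_nontrivial_iff_subsingleton] at hcon
    exact htop (by rw [← hker, LinearMap.ker_eq_top]; exact LinearMap.ext fun _ =>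
      Subsingleton.elim _ _)
  have hsyz : IsSyzygy Λ X N := ⟨(projectiveCover Λ T).1, f, p, hP, hf,
    LinearMap.exact_iff.mpr hker, hp⟩
  refine ⟨N, ⟨⟨Module.Finite.of_surjective p hp, hPu.of_surjective hp, hNn, fun hproj => ?_⟩,
    ?_, ?_⟩, hsyz⟩
  · have h1 := LinearMap.ker_eq_bot.mpr (hP.indecomposable.bijective_of_surjective hp).1
    exact hbot (hker ▸ h1)
  · obtain ⟨b⟩ := hPu.nonempty_top_equiv_top hp
    obtain ⟨c⟩ := hPu.nonempty_top_equiv (isProjectiveCover_projCoverMap Λ T).surjective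
    exact hT.congr (c.symm.trans b)
  · obtain ⟨b⟩ := hsyz.nonempty_top_equiv_translate_socle (R := R) hl hr hns
    exact h.top.congr b

/-- Splicing short exact sequences to a complete projective resolution. -/
theorem isGorensteinProjective_of_isSyzygy [IsArtinianRing Λ] (hl : IsLeftSerial Λ)
    (hr : IsLeftSerial Λᵐᵒᵖ) (M : ℤ → ModuleCat.{u} Λ)
    (hM : ∀ i, IsCyclicallyBlackModule R Λ (M i)) (hsyz : ∀ i, IsSyzygy Λ (M (i + 1)) (M i)) :
    IsGorensteinProjective Λ (M 1) := by
  choose P f g hP hf hfg hg using hsyz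
  have hker : ∀ i, LinearMap.ker (f i ∘ₗ g (i + 1)) = LinearMap.range (f (i + 1)) := by
    intro i
    rw [LinearMap.ker_comp, LinearMap.ker_eq_bot.mpr (hf i), Submodule.comap_bot,
      (hfg (i + 1)).linearMap_ker_eq]
  have hrange : ∀ i, LinearMap.range (f i ∘ₗ g (i + 1)) = LinearMap.range (f i) := fun i => by
    rw [LinearMap.range_comp, LinearMap.range_eq_top.mpr (hg (i + 1)), Submodule.map_top]
  refine ⟨P, fun i => f i ∘ₗ g (i + 1), ⟨fun i => (hP i).finite, fun i => (hP i).projective,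
    fun i => ?_, fun i => ?_⟩, ⟨?_⟩⟩
  · rw [LinearMap.exact_iff, hker, hrange]
  · intro u
    constructor
    · intro hu
      -- A cocycle `u` vanishes on `ker g (i + 1)`, so it descends to `M (i + 1)`. From there it
      -- extends to `P i` because `top (M i)` is black.
      have h1 : ∀ x, u (f (i + 1) x) = 0 := by
        intro x
        obtain ⟨y, rfl⟩ := hg (i + 1 + 1) x
        exact LinearMap.congr_fun hu y
      have h2 : LinearMap.ker (g (i + 1)) ≤ LinearMap.ker u := by
        rw [(hfg (i + 1)).linearMap_ker_eq]
        rintro _ ⟨x, rfl⟩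
        exact h1 x
      obtain ⟨u', hu'⟩ := LinearMap.exists_comp_eq_of_ker_le (hg (i + 1)) h2
      have := (hM i).nonprojective.nontrivial
      have := (hM (i + 1)).nonprojective.nontrivial
      obtain ⟨v, hv⟩ := exists_extension_of_isCyclicallyBlack_top hl hr (hP i) (hM i).top (hf i) (hg i) u'
      refine ⟨v, LinearMap.ext fun x => ?_⟩
      rw [← hu' x]
      exact LinearMap.congr_fun hv _
    · rintro ⟨v, rfl⟩
      refine LinearMap.ext fun x => ?_
      have h1 : f (i + 1) (g (i + 1 + 1) x) ∈ LinearMap.ker (f i ∘ₗ g (i + 1)) := by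
        rw [hker]
        exact ⟨_, rfl⟩
      exact (congrArg v h1).trans (map_zero v)
  · exact (LinearEquiv.ofInjective (f 0) (hf 0)).trans (LinearEquiv.ofEq _ _ (hrange 0).symm)

theorem IsCyclicallyBlackModule.isGorensteinProjective [IsArtinianRing R] [Module.Finite R Λ]
    [IsArtinianRing Λ] (hl : IsLeftSerial Λ) (hr : IsLeftSerial Λᵐᵒᵖ)
    (hns : NoSimpleProjective Λ) (h : IsCyclicallyBlackModule R Λ X) :
    IsGorensteinProjective Λ X := by
  let V := {N : ModuleCat.{u} Λ // IsCyclicallyBlackModule R Λ N}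
  have hprev : ∀ N : V, ∃ N' : V, IsSyzygy Λ N.1 N'.1 := by
    rintro ⟨N, hN⟩
    obtain ⟨N', h1, h2⟩ := hN.exists_isSyzygy hl hr hns
    exact ⟨⟨N', h1⟩, h2⟩
  have hnext : ∀ N : V, ∃ N' : V, IsSyzygy Λ N'.1 N.1 := fun N =>
    ⟨⟨ModuleCat.of Λ (_root_.syzygy Λ N.1), N.2.syzygy hl hr hns⟩,
      isSyzygy_syzygy N.2.nonprojective⟩
  choose prev hprev using hprev
  choose next hnext using hnext
  let X₀ : V := ⟨ModuleCat.of Λ X, h⟩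
  -- The image of `d 0` is `M 1`, so `X` is placed at index 1, with syzygies at the larger indices
  -- and cosyzygies at 0 and the negative ones.
  let M : ℤ → V := fun i => match i with
    | Int.ofNat 0 => prev X₀
    | Int.ofNat (n + 1) => next^[n] X₀
    | Int.negSucc n => prev^[n + 1] (prev X₀)
  refine isGorensteinProjective_of_isSyzygy hl hr (fun i => (M i).1) (fun i => (M i).2)
    fun i => ?_
  match i with
  | Int.ofNat 0 => exact hprev X₀
  | Int.ofNat (n + 1) =>
    change IsSyzygy Λ (next^[n + 1] X₀).1 (next^[n] X₀).1
    rw [Function.iterate_succ_apply']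
    exact hnext _
  | Int.negSucc 0 => exact hprev (prev X₀)
  | Int.negSucc (n + 1) =>
    change IsSyzygy Λ (prev^[n + 1] (prev X₀)).1 (prev^[n + 2] (prev X₀)).1
    rw [Function.iterate_succ_apply' prev (n + 1)]
    exact hprev _

end Resolution

theorem lemma5 {R Λ : Type u} [CommRing R] [Ring Λ] [Algebra R Λ]
    (hΛ : IsNakayamaAlgebra R Λ) (hns : NoSimpleProjective Λ)
    (M : Type u) [AddCommGroup M] [Module Λ M] (hfin : IsFiniteLength Λ M)
    (hind : IsIndecomposable Λ M) (hproj : ¬ Module.Projective Λ M) :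
    List.TFAE
      [IsGorensteinProjective Λ M,
       IsCyclicallyBlack R Λ (ModuleTop Λ M) ∧
         IsCyclicallyBlack R Λ (ModuleTop Λ (syzygy Λ M)),
       IsCyclicallyBlack R Λ (ModuleTop Λ M) ∧
         IsCyclicallyBlack R Λ (ARTranslate R Λ (socle Λ M))] := by
  have := hΛ.isArtinianRing
  have := hΛ.finite
  have : IsArtinianRing Λ := IsArtinianRing.of_finite R Λ
  have : Module.Finite R Λᵐᵒᵖ :=
    Module.Finite.equiv (MulOpposite.opLinearEquiv R : Λ ≃ₗ[R] Λᵐᵒᵖ)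
  have : IsArtinianRing Λᵐᵒᵖ := IsArtinianRing.of_finite R Λᵐᵒᵖ
  have hl := hΛ.left
  have hr := hΛ.right
  have := (isFiniteLength_iff_isNoetherian_isArtinian.mp hfin).1
  have hMn := hind.1
  have hM : IsNonprojectiveUniserial Λ M :=
    ⟨inferInstance, hind.isUniserial hl hr, hMn, hproj⟩
  have hn := nontrivial_syzygy hproj
  -- The last two conditions differ only by this isomorphism `top ΩM ≅ τ soc M`.
  obtain ⟨e⟩ := (isSyzygy_syzygy hM).nonempty_top_equiv_translate_socle (R := R) hl hr hns
  tfae_have 1 → 2 := fun h =>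
    have hG := h.isGorensteinRetract
    ⟨hG.isCyclicallyBlack_top hl hr hns hM,
      (hG.syzygy hM).isCyclicallyBlack_top hl hr hns (hM.syzygy hl hG)⟩
  tfae_have 2 → 3 := fun h => ⟨h.1, h.2.congr e⟩
  tfae_have 3 → 1 := fun h =>
    IsCyclicallyBlackModule.isGorensteinProjective hl hr hns ⟨hM, h.1, h.2⟩
  tfae_finish
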